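/- Let $d\in\{2,3\}$, $k_d=\binom d2$, and let $\mu_\sigma,\mu_\sigma^c,\mu_\omega,\mu_\omega^c>0$, $\lambda_\sigma,\lambda_\omega\ge 0$ be constants. Let $\mathcal A_\sigma$ be the inverse of $\tau\mapsto 2\mu_\sigma\,\mathrm{sym}\,\tau+2\mu_\sigma^c\,\mathrm{skw}\,\tau+\lambda_\sigma(\mathrm{Tr}\,\tau)I$ on $\mathbb R^{d\times d}$, and let $\mathcal A_\omega$ be the inverse of $\tau\mapsto 2\mu_\omega\,\mathrm{sym}\,\tau+2\mu_\omega^c\,\mathrm{skw}\,\tau+\lambda_\omega(\mathrm{Tr}\,\tau)I$ if $d=3$ and of $\tau\mapsto 2\mu_\omega\tau$ if $d=2$. Let $\mathrm{asym}\,\tau=\tau_{21}-\tau_{12}$ if $d=2$ and $\mathrm{asym}\,\tau=(\tau_{32}-\tau_{23},\tau_{13}-\tau_{31},\tau_{21}-\tau_{12})$ if $d=3$. Let $\Omega\subset\mathbb R^d$ be a bounded Lipschitz domain whose boundary is the disjoint union of $\partial_e\Omega$ and $\partial_n\Omega$, let $\ell\ge0$ be a continuous function on $\Omega$ with $\ell,\nabla\ell\in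 L^\infty(\Omega)$, and let $\Omega_h$ be a finite simplicial tessellation of $\Omega$. Write $(\cdot,\cdot)_\Omega$ and $\|\cdot\|_\Omega$ for the $L^2(\Omega)$ inner product and norm, and put $$\Sigma=\{\sigma\in L^2(\Omega;\mathbb R^{d\times d}):\nabla\cdot\sigma\in L^2,\ n\cdot\sigma|_{\partial_e\Omega}=0\},\qquad W=\{\omega\in L^2(\Omega;\mathbb R^{d\times k_d}):\nabla\cdot(\ell\omega)\in L^2,\ n\cdot\ell\omega|_{\partial_e\Omega}=0\},$$ with weak divergences and normal traces, and $Y=L^2(\Omega;\mathbb R^d)\times L^2(\Omega;\mathbb R^{k_d})$ with $\|(u,r)\|_Y^2=\|u\|_\Omega^2+\|r\|_\Omega^2$. With $P_k$ the discontinuous elementwise polynomials of degree at most $k$ on $\Omega_h$, let $\Sigma_h\subseteq \Sigma\cap P_2^{d\times d}$, $W_h\subseteq W\cap P_2^{d\times k_d}$, $U_h\subseteq P_1^d$ and $R_h\subseteq P_1^{k_d}$ be linear subspaces, let $X_h=\Sigma_h\times W_h$ and $Y_h=U_h\times R_h$, and let $\Pi_R$ be the $L^2$ projection onto $R_h$.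 For $\eta=(\sigma,\omega)\in X_h$ and $v=(u,r)\in Y_h$ let $$\|\eta\|_{X_h}^2=\|\sigma\|_\Omega^2+\|\nabla\cdot\sigma\|_\Omega^2+\|\omega\|_\Omega^2+\|\Pi_R\nabla\cdot(\ell\omega)\|_\Omega^2,\qquad \langle B\eta,v\rangle=-(\nabla\cdot\sigma,u)_\Omega+(\mathrm{asym}\,\sigma,r)_\Omega-(\nabla\cdot(\ell\omega),r)_\Omega .$$ Let $(\cdot,\cdot)_Q$ be one of the two discrete inner products $$(\phi,\psi)_{Q_1}=\sum_{\Delta\in\Omega_h}\frac{|\Delta|}{d+1}\sum_{x_i\in\mathcal N(\Delta)}\phi_\Delta(x_i)\cdot\psi_\Delta(x_i),\qquad (\phi,\psi)_{Q_2}=\frac1{d+2}\Big((\phi,\psi)_{Q_1}+(d+1)\sum_{\Delta\in\Omega_h}|\Delta|\,\phi_\Delta(x_\Delta)\cdot\psi_\Delta(x_\Delta)\Big),$$ where $\phi_\Delta$ is the restriction of $\phi$ to $\Delta$, $\mathcal N(\Delta)$ is the set of vertices and $x_\Delta$ the center of $\Delta$. Let $\|\eta\|_\Omega^2=\|\sigma\|_\Omega^2+\|\omega\|_\Omega^2$,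 $\|\eta\|_Q^2=(\sigma,\sigma)_Q+(\omega,\omega)_Q$ and $\langle A_h\eta,\eta'\rangle=(\mathcal A_\sigma\sigma,\sigma')_Q+(\mathcal A_\omega\omega,\omega')_Q$. Suppose that, with constants $\beta,c_1,c_2>0$: 1. $\nabla\cdot\Sigma_h\subseteq U_h$; 2. the triplet $\Sigma_h\times U_h\times R_h$ is elasticity-stable: $$\inf_{0\ne(u,r)\in U_h\times R_h}\ \sup_{0\neq\sigma\in\Sigma_h}\frac{(\nabla\cdot\sigma,u)_\Omega+(\mathrm{asym}\,\sigma,r)_\Omega}{(\|\sigma\|_\Omega^2+\|\nabla\cdot\sigma\|_\Omega^2)^{1/2}\,\|(u,r)\|_Y}\ \ge\ \beta;$$ 3. $c_1\|\eta\|_\Omega\le\|\eta\|_Q\le c_2\|\eta\|_\Omega$ for all $\eta\in X_h$. Then for all linear functionals $g\in X_h'$ and $f\in Y'$ there is exactly one pair $(\hat\eta_h,\hat v_h)\in X_h\times Y_h$ with $$\langle A_h\hat\eta_h,\eta'\rangle-\langle B\eta',\hat v_h\rangle+\langle B\hat\eta_h,v'\rangle=\langle g,\eta'\rangle+\langle f,v'\rangle\qquad\text{for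 all }(\eta',v')\in X_h\times Y_h,$$ and it satisfies $$\|\hat\eta_h\|_{X_h}+\|\hat v_h\|_Y\le C\,\big(\|g\|_{X_h'}+\|f\|_{Y'}\big),\qquad \|g\|_{X_h'}=\sup_{0\ne\eta\in X_h}\frac{\langle g,\eta\rangle}{\|\eta\|_{X_h}},$$ where $C$ depends only on $d$, the material parameters, $\beta$, $c_1$ and $c_2$; in particular it is independent of the mesh (size) and of $\ell$. (A supremum over the empty set is $0$.) -/

import Mathlib

open MeasureTheory Topology
open scoped ContDiff InnerProductSpace

namespace Cosserat

noncomputable section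

/-- The space `ℝ^d` with its Euclidean norm. -/
abbrev Pt (d : ℕ) : Type := EuclideanSpace ℝ (Fin d)

/-! ### Pointwise algebra

Tensors are vectors indexed by pairs (row, column), with the Frobenius inner product.
`d × d` matrices model values of the Cauchy stress.  The couple stress takes values in
`ℝ^{d × k_d}`, `k_d = d.choose 2`; the index is written (rotation component, space direction), so
that the divergence always contracts the second index: for `d = 2` this is a vector of length two,
for `d = 3` a `3 × 3` matrix, and the divergence is taken row by row. -/

/-- The values of the Cauchy stress: `d × d` matrices. -/
abbrev StressVal (d : ℕ) : Type := EuclideanSpace ℝ (Fin d × Fin d)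

/-- The values of the rotation: vectors with `k_d = d.choose 2` components. -/
abbrev RotVal (d : ℕ) : Type := EuclideanSpace ℝ (Fin (d.choose 2))

/-- The values of the couple stress. -/
abbrev CoupleVal (d : ℕ) : Type := EuclideanSpace ℝ (Fin (d.choose 2) × Fin d)

/-- `τ ↦ 2 μ sym τ + 2 μc skw τ + lam (Tr τ) I`. -/
def stiffness {d : ℕ} (μ μc lam : ℝ) (τ : StressVal d) : StressVal d :=
  WithLp.toLp 2 fun ij =>
    2 * μ * ((τ (ij.1, ij.2) + τ (ij.2, ij.1)) / 2)
      + 2 * μc * ((τ (ij.1, ij.2) - τ (ij.2, ij.1)) / 2)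
      + if ij.1 = ij.2 then lam * ∑ k, τ (k, k) else 0

/-- `τ ↦ (1 / 2μ) (sym τ - lam / (2μ + d lam) (Tr τ) I) + (1 / 2μc) skw τ`. -/
def compliance {d : ℕ} (μ μc lam : ℝ) (τ : StressVal d) : StressVal d :=
  WithLp.toLp 2 fun ij =>
    1 / (2 * μ) * ((τ (ij.1, ij.2) + τ (ij.2, ij.1)) / 2
        - if ij.1 = ij.2 then lam / (2 * μ + d * lam) * ∑ k, τ (k, k) else 0)
      + 1 / (2 * μc) * ((τ (ij.1, ij.2) - τ (ij.2, ij.1)) / 2)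

/-- The compliance is a right inverse of the stiffness. -/
theorem stiffness_compliance {d : ℕ} {μ μc lam : ℝ} (hμ : 0 < μ) (hμc : 0 < μc) (hl : 0 ≤ lam)
    (τ : StressVal d) : stiffness μ μc lam (compliance μ μc lam τ) = τ := by
  have h : 2 * μ + d * lam ≠ 0 := by positivity
  ext ⟨i, j⟩
  by_cases hij : i = j
  · subst hij
    simp only [stiffness, compliance, if_true, sub_self, zero_div, mul_zero, add_zero]
    rw [← Finset.mul_sum, Finset.sum_sub_distrib, Finset.sum_const, Finset.card_univ,
      Fintype.card_fin, nsmul_eq_mul]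
    have h2 : ∀ x : Fin d, (τ (x, x) + τ (x, x)) / 2 = τ (x, x) := fun x => by ring
    simp only [h2]
    field_simp
    ring
  · have hji : ¬ j = i := fun h => hij h.symm
    simp only [stiffness, compliance, if_neg hij, if_neg hji, sub_zero, add_zero]
    field_simp
    ring

/-- The compliance is a left inverse of the stiffness. -/
theorem compliance_stiffness {d : ℕ} {μ μc lam : ℝ} (hμ : 0 < μ) (hμc : 0 < μc) (hl : 0 ≤ lam)
    (τ : StressVal d) : compliance μ μc lam (stiffness μ μc lam τ) = τ := by
  have h : 2 * μ + d * lam ≠ 0 := by positivity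
  ext ⟨i, j⟩
  by_cases hij : i = j
  · subst hij
    simp only [stiffness, compliance, if_true, sub_self, zero_div, mul_zero, add_zero]
    rw [Finset.sum_add_distrib, ← Finset.mul_sum, Finset.sum_const, Finset.card_univ,
      Fintype.card_fin, nsmul_eq_mul]
    have h2 : ∀ x : Fin d, (τ (x, x) + τ (x, x)) / 2 = τ (x, x) := fun x => by ring
    simp only [h2]
    field_simp
    ring
  · have hji : ¬ j = i := fun h => hij h.symm
    simp only [stiffness, compliance, if_neg hij, if_neg hji, sub_zero, add_zero]
    field_simp
    ring

/-- The material parameters of a Cosserat medium. -/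
structure Material where
  (muS muSc lamS muW muWc lamW : ℝ)
  muS_pos : 0 < muS
  muSc_pos : 0 < muSc
  lamS_nonneg : 0 ≤ lamS
  muW_pos : 0 < muW
  muWc_pos : 0 < muWc
  lamW_nonneg : 0 ≤ lamW

/-- The inverse `𝒜_σ` of the material tensor of the Cauchy stress. -/
def Material.complS (m : Material) {d : ℕ} : StressVal d → StressVal d :=
  compliance m.muS m.muSc m.lamS

/-- The inverse `𝒜_ω` of the material tensor of the couple stress, which is
`τ ↦ 2 μ_ω sym τ + 2 μ_ω^c skw τ + λ_ω (Tr τ) I` for `d = 3` and `τ ↦ 2 μ_ω τ` for `d = 2`. -/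
def Material.complW (m : Material) : {d : ℕ} → CoupleVal d → CoupleVal d
  | 3, τ => compliance (d := 3) m.muW m.muWc m.lamW τ
  | _, τ => (1 / (2 * m.muW)) • τ

/-- The asymmetry operator in two dimensions. -/
def asym2 : StressVal 2 →ₗ[ℝ] EuclideanSpace ℝ (Fin 1) where
  toFun τ := WithLp.toLp 2 ![τ (1, 0) - τ (0, 1)]
  map_add' a b := by ext i; fin_cases i; simp; ring
  map_smul' c a := by ext i; fin_cases i; simp; ring

/-- The asymmetry operator in three dimensions. -/
def asym3 : StressVal 3 →ₗ[ℝ] EuclideanSpace ℝ (Fin 3) where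
  toFun τ := WithLp.toLp 2
    ![τ (2, 1) - τ (1, 2), τ (0, 2) - τ (2, 0), τ (1, 0) - τ (0, 1)]
  map_add' a b := by ext i; fin_cases i <;> simp <;> ring
  map_smul' c a := by ext i; fin_cases i <;> simp <;> ring

/-- The asymmetry operator (only `d = 2` and `d = 3` are used). -/
def asym : (d : ℕ) → StressVal d →ₗ[ℝ] RotVal d
  | 2 => asym2
  | 3 => asym3
  | _ => 0

/-! ### Domain, function spaces, weak divergence -/

/-- A bounded Lipschitz domain: near each boundary point, `Ω` is the strict epigraph of a Lipschitz
function over a hyperplane. -/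
def IsLipschitzDomain {d : ℕ} (Ω : Set (Pt d)) : Prop :=
  IsOpen Ω ∧ IsConnected Ω ∧ Bornology.IsBounded Ω ∧
    ∀ x ∈ frontier Ω, ∃ ν : Pt d, ‖ν‖ = 1 ∧
      ∃ (γ : (Submodule.span ℝ {ν})ᗮ → ℝ) (K : NNReal), LipschitzWith K γ ∧
        ∀ᶠ y in 𝓝 x, (y ∈ Ω ↔ γ ((Submodule.span ℝ {ν})ᗮ.orthogonalProjectionOnto y) < ⟪ν, y⟫_ℝ)

/-- `L²(Ω)` with values in `ℝ^ι`. -/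
abbrev L2 {d : ℕ} (Ω : Set (Pt d)) (ι : Type) [Fintype ι] : Type :=
  Lp (EuclideanSpace ℝ ι) 2 (volume.restrict Ω)

/-- Scalar test functions: smooth, compactly supported in `ℝ^d`, with zero trace on the part `Γn` of
the boundary (zero almost everywhere with respect to the surface measure). -/
def IsTest {d : ℕ} (Γn : Set (Pt d)) (φ : Pt d → ℝ) : Prop :=
  ContDiff ℝ ∞ φ ∧ HasCompactSupport φ ∧ μHE[d - 1] {x ∈ Γn | φ x ≠ 0} = 0

/-- `g` is the weak row-wise divergence of `f` in `Ω`, and the normal trace of `f` vanishes on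
`∂Ω \ Γn`, in the weak sense of Green's formula. -/
def IsWeakDiv {d : ℕ} {ι : Type} [Fintype ι] (Ω Γn : Set (Pt d))
    (f : Pt d → EuclideanSpace ℝ (ι × Fin d)) (g : L2 Ω ι) : Prop :=
  ∀ φ : Pt d → ℝ, IsTest Γn φ → ∀ i : ι,
    ∫ x in Ω, ∑ j, f x (i, j) * fderiv ℝ φ x (EuclideanSpace.single j 1)
      = - ∫ x in Ω, g x i * φ x

open Classical in
/-- The weak divergence in `L²(Ω)` of a field with zero normal trace on `∂Ω \ Γn` (it is unique up
to null sets); zero by convention if there is none. -/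
def weakDiv {d : ℕ} {ι : Type} [Fintype ι] (Ω Γn : Set (Pt d))
    (f : Pt d → EuclideanSpace ℝ (ι × Fin d)) : L2 Ω ι :=
  if h : ∃ g : L2 Ω ι, IsWeakDiv Ω Γn f g then h.choose else 0

/-- The space `Σ` of Cauchy stresses. -/
def spaceS {d : ℕ} (Ω Γn : Set (Pt d)) : Set (L2 Ω (Fin d × Fin d)) :=
  {σ | ∃ g : L2 Ω (Fin d), IsWeakDiv Ω Γn σ g}

/-- The space `W` of couple stresses: `ω ∈ L²` with `∇ ⋅ (ℓ ω) ∈ L²` and zero normal trace of `ℓ ω`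
on the essential boundary. -/
def spaceW {d : ℕ} (Ω Γn : Set (Pt d)) (ℓ : Pt d → ℝ) : Set (L2 Ω (Fin (d.choose 2) × Fin d)) :=
  {w | ∃ g : L2 Ω (Fin (d.choose 2)), IsWeakDiv Ω Γn (fun x => ℓ x • w x) g}

/-- Admissible length scales: continuous and nonnegative in `Ω`, with `ℓ` and its weak gradient
essentially bounded. -/
def IsLengthScale {d : ℕ} (Ω : Set (Pt d)) (ℓ : Pt d → ℝ) : Prop :=
  ContinuousOn ℓ Ω ∧ (∀ x ∈ Ω, 0 ≤ ℓ x) ∧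
    ∃ (M : ℝ) (G : Pt d → Pt d), AEStronglyMeasurable G (volume.restrict Ω) ∧
      (∀ᵐ x ∂(volume.restrict Ω), |ℓ x| ≤ M ∧ ‖G x‖ ≤ M) ∧
      ∀ φ : Pt d → ℝ, ContDiff ℝ ∞ φ → HasCompactSupport φ → tsupport φ ⊆ Ω → ∀ j,
        ∫ x in Ω, ℓ x * fderiv ℝ φ x (EuclideanSpace.single j 1) = - ∫ x in Ω, G x j * φ x

/-- The space `Y = U × R = L² × L²`, with the norm `(‖u‖² + ‖r‖²)^{1/2}`. -/
abbrev SpaceY {d : ℕ} (Ω : Set (Pt d)) : Type :=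
  WithLp 2 (L2 Ω (Fin d) × L2 Ω (Fin (d.choose 2)))

/-- The asymmetry operator applied pointwise almost everywhere. -/
def asymL2 {d : ℕ} (Ω : Set (Pt d)) : L2 Ω (Fin d × Fin d) →L[ℝ] L2 Ω (Fin (d.choose 2)) :=
  (LinearMap.toContinuousLinearMap (asym d)).compLpL 2 (volume.restrict Ω)

/-! ### Meshes and piecewise polynomials -/

/-- A finite simplicial tessellation of `Ω`.  (An affine `d`-simplex is nondegenerate.) -/
structure Tessellation {d : ℕ} (Ω : Set (Pt d)) where
  Elem : Type
  fintypeElem : Fintype Elem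
  simplex : Elem → Affine.Simplex ℝ (Pt d) d
  cover : closure Ω = ⋃ T, convexHull ℝ (Set.range (simplex T).points)
  interior_subset : ∀ T, interior (convexHull ℝ (Set.range (simplex T).points)) ⊆ Ω
  disjoint_interior : ∀ T T', T ≠ T' →
    Disjoint (interior (convexHull ℝ (Set.range (simplex T).points)))
      (interior (convexHull ℝ (Set.range (simplex T').points)))

attribute [instance] Tessellation.fintypeElem

namespace Tessellation

variable {d : ℕ} {Ω : Set (Pt d)} (𝒯 : Tessellation Ω)

/-- The closed element. -/
def cell (T : 𝒯.Elem) : Set (Pt d) := convexHull ℝ (Set.range (𝒯.simplex T).points)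

/-- The measure of the element. -/
def vol (T : 𝒯.Elem) : ℝ := (volume (𝒯.cell T)).toReal

/-- The nodes (vertices) of the element. -/
def node (T : 𝒯.Elem) (i : Fin (d + 1)) : Pt d := (𝒯.simplex T).points i

/-- The center (barycenter) of the element. -/
def center (T : 𝒯.Elem) : Pt d := (1 / ((d : ℝ) + 1)) • ∑ i, 𝒯.node T i

/-- The space `P_k` of elementwise, discontinuous polynomial fields of degree at most `k`, with
values in `ℝ^ι`: one polynomial for each element and each component. -/
abbrev PW (k : ℕ) (ι : Type) : Type :=
  𝒯.Elem → ι → MvPolynomial.restrictTotalDegree (Fin d) ℝ k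

variable {𝒯} {k : ℕ} {ι : Type}

/-- The value at `x` of the polynomial that represents the field on the element `T`. -/
def valueOn (p : 𝒯.PW k ι) (T : 𝒯.Elem) (x : Pt d) : EuclideanSpace ℝ ι :=
  WithLp.toLp 2 fun i => MvPolynomial.eval (fun j => x j) (p T i : MvPolynomial (Fin d) ℝ)

/-- The field as a function on `ℝ^d`: in the interior of an element it is the polynomial of that
element, and it is zero on the (null) set of points interior to no element. -/
def toFun (p : 𝒯.PW k ι) (x : Pt d) : EuclideanSpace ℝ ι :=
  ∑ T, (interior (𝒯.cell T)).indicator (valueOn p T) x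

theorem continuous_valueOn [Fintype ι] (p : 𝒯.PW k ι) (T : 𝒯.Elem) :
    Continuous (valueOn p T) := by
  refine (PiLp.continuous_toLp 2 _).comp (continuous_pi fun i => ?_)
  exact (MvPolynomial.continuous_eval _).comp (continuous_pi fun j => by fun_prop)

theorem isCompact_cell (T : 𝒯.Elem) : IsCompact (𝒯.cell T) :=
  (Set.finite_range _).isCompact_convexHull ℝ

theorem memLp_toFun [Fintype ι] (p : 𝒯.PW k ι) :
    MemLp (toFun p) 2 (volume.restrict Ω) := by
  refine MemLp.restrict Ω ?_
  have h : toFun p = fun x => ∑ T, (interior (𝒯.cell T)).indicator (valueOn p T) x := rfl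
  rw [h]
  refine memLp_finsetSum _ fun T _ => ?_
  rw [memLp_indicator_iff_restrict isOpen_interior.measurableSet]
  have hc := (continuous_valueOn p T).continuousOn (s := 𝒯.cell T)
  obtain ⟨C, hC⟩ := (isCompact_cell T).exists_bound_of_continuousOn hc
  have : IsFiniteMeasure (volume.restrict (interior (𝒯.cell T))) :=
    ⟨by
      rw [Measure.restrict_apply_univ]
      exact (measure_mono _root_.interior_subset).trans_lt (isCompact_cell T).measure_lt_top⟩
  refine MemLp.of_bound (continuous_valueOn p T).aestronglyMeasurable C ?_
  exact (ae_restrict_iff' isOpen_interior.measurableSet).2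
    (Filter.Eventually.of_forall fun x hx => hC x (_root_.interior_subset hx))

theorem toFun_add (p q : 𝒯.PW k ι) : toFun (p + q) = toFun p + toFun q := by
  have h : ∀ T, valueOn (p + q) T = valueOn p T + valueOn q T := fun T => by
    ext x i; simp [valueOn]
  ext x : 1
  simp only [toFun, h, Set.indicator_add', Pi.add_apply, Finset.sum_add_distrib]

theorem toFun_smul (c : ℝ) (p : 𝒯.PW k ι) : toFun (c • p) = c • toFun p := by
  have h : ∀ T, valueOn (c • p) T = c • valueOn p T := fun T => by
    ext x i; simp [valueOn]
  ext x : 1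
  simp only [toFun, h, Pi.smul_apply, Finset.smul_sum]
  exact Finset.sum_congr rfl fun T _ => Set.indicator_const_smul_apply _ c _ x

/-- A piecewise polynomial field as an element of `L²(Ω)`. -/
def toL2 [Fintype ι] : 𝒯.PW k ι →ₗ[ℝ] L2 Ω ι where
  toFun p := (memLp_toFun p).toLp
  map_add' p q := by
    rw [← MemLp.toLp_add]; exact MemLp.toLp_congr _ _ (by rw [toFun_add])
  map_smul' c p := by
    rw [RingHom.id_apply, ← MemLp.toLp_const_smul]
    exact MemLp.toLp_congr _ _ (by rw [toFun_smul])

/-- The two low-order quadrature rules: the vertex rule `Q₁`, and the rule `Q₂` with the vertices and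
the element center as nodes. -/
inductive Rule
  | Q1
  | Q2

/-- The discrete inner product `(φ, ψ)_{Q₁}`, also for functions `F`, `G` of (element, point). -/
def quad1 [Fintype ι] (F G : 𝒯.Elem → Pt d → EuclideanSpace ℝ ι) : ℝ :=
  ∑ T, 𝒯.vol T / ((d : ℝ) + 1) * ∑ i, ⟪F T (𝒯.node T i), G T (𝒯.node T i)⟫_ℝ

/-- The discrete inner product `(φ, ψ)_Q` for the two rules. -/
def quad [Fintype ι] (Q : Rule) (F G : 𝒯.Elem → Pt d → EuclideanSpace ℝ ι) : ℝ :=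
  match Q with
  | .Q1 => quad1 F G
  | .Q2 => 1 / ((d : ℝ) + 2) * (quad1 F G
      + ((d : ℝ) + 1) * ∑ T, 𝒯.vol T * ⟪F T (𝒯.center T), G T (𝒯.center T)⟫_ℝ)

end Tessellation

open Tessellation

/-! ### The discrete Cosserat problem -/

/-- A choice of finite element spaces `Σ_h ⊆ P₂^{d × d}`, `W_h ⊆ P₂^{d × k_d}`, `U_h ⊆ P₁^d`,
`R_h ⊆ P₁^{k_d}` on a tessellation. -/
structure FESpaces {d : ℕ} {Ω : Set (Pt d)} (𝒯 : Tessellation Ω) where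
  S : Submodule ℝ (𝒯.PW 2 (Fin d × Fin d))
  W : Submodule ℝ (𝒯.PW 2 (Fin (d.choose 2) × Fin d))
  U : Submodule ℝ (𝒯.PW 1 (Fin d))
  R : Submodule ℝ (𝒯.PW 1 (Fin (d.choose 2)))

namespace FESpaces

variable {d : ℕ} {Ω : Set (Pt d)} {𝒯 : Tessellation Ω} (V : FESpaces 𝒯)

/-- `X_h = Σ_h × W_h`. -/
abbrev X : Type := V.S × V.W

/-- `Y_h = U_h × R_h`. -/
abbrev Y : Type := V.U × V.R

variable {V}

/-- An element of `Y_h` as an element of `Y = L² × L²`. -/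
def yL2 (v : V.Y) : SpaceY Ω := WithLp.toLp 2 (toL2 v.1.1, toL2 v.2.1)

/-- `∇ ⋅ σ` for a discrete Cauchy stress. -/
def divS (Γn : Set (Pt d)) (σ : V.S) : L2 Ω (Fin d) := weakDiv Ω Γn (toL2 σ.1)

/-- `∇ ⋅ (ℓ ω)` for a discrete couple stress. -/
def divW (Γn : Set (Pt d)) (ℓ : Pt d → ℝ) (w : V.W) : L2 Ω (Fin (d.choose 2)) :=
  weakDiv Ω Γn (fun x => ℓ x • (toL2 w.1 : L2 Ω (Fin (d.choose 2) × Fin d)) x)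

variable (V)

/-- The spaces are conforming: `Σ_h ⊆ Σ` and `W_h ⊆ W` (`U_h ⊆ L²` and `R_h ⊆ L²` always hold). -/
def Conforming (Γn : Set (Pt d)) (ℓ : Pt d → ℝ) : Prop :=
  (∀ σ ∈ V.S, toL2 σ ∈ spaceS Ω Γn) ∧ ∀ w ∈ V.W, toL2 w ∈ spaceW Ω Γn ℓ

/-- `∇ ⋅ Σ_h ⊆ U_h`. -/
def DivSubset (Γn : Set (Pt d)) : Prop :=
  ∀ σ : V.S, ∃ u ∈ V.U, toL2 u = divS Γn σ

/-- The triplet `Σ_h × U_h × R_h` is elasticity-stable with constant `β`: the infimum over the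
nonzero `(u, r) ∈ U_h × R_h` of the supremum over `σ ∈ Σ_h` of
`((∇ ⋅ σ, u) + (asym σ, r)) / (‖(σ, 0)‖_X ‖(u, r)‖_Y)` is at least `β`. -/
def ElasticityStable (Γn : Set (Pt d)) (β : ℝ) : Prop :=
  ∀ v : V.Y, v ≠ 0 →
    β ≤ ⨆ σ : V.S, (⟪divS Γn σ, toL2 v.1.1⟫_ℝ + ⟪asymL2 Ω (toL2 σ.1), toL2 v.2.1⟫_ℝ)
      / (√(‖toL2 σ.1‖ ^ 2 + ‖divS Γn σ‖ ^ 2) * ‖yL2 v‖)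

/-- The rotation space `R_h` as a subspace of `L²(Ω)`. -/
def RL2 : Submodule ℝ (L2 Ω (Fin (d.choose 2))) := V.R.map toL2

instance : FiniteDimensional ℝ V.RL2 := by
  unfold RL2; infer_instance

instance : CompleteSpace V.RL2 := FiniteDimensional.complete ℝ _

variable {V}

/-- The discrete norm `‖η‖_{X_h}`, in which the divergence of the couple stress is projected
orthogonally onto `R_h`. -/
def normX (Γn : Set (Pt d)) (ℓ : Pt d → ℝ) (η : V.X) : ℝ :=
  √(‖toL2 η.1.1‖ ^ 2 + ‖divS Γn η.1‖ ^ 2 + ‖toL2 η.2.1‖ ^ 2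
    + ‖V.RL2.starProjection (divW Γn ℓ η.2)‖ ^ 2)

/-- The dual norm `‖g‖_{X_h'}`. -/
def dualNormX (Γn : Set (Pt d)) (ℓ : Pt d → ℝ) (g : V.X →ₗ[ℝ] ℝ) : ℝ :=
  ⨆ η : V.X, g η / normX Γn ℓ η

/-- The `L²` norm of `η = (σ, ω)`. -/
def normL2 (η : V.X) : ℝ := √(‖toL2 η.1.1‖ ^ 2 + ‖toL2 η.2.1‖ ^ 2)

/-- The quadrature norm `‖η‖_Q` of `η = (σ, ω)`. -/
def normQ (Q : Rule) (η : V.X) : ℝ :=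
  √(quad Q (valueOn η.1.1) (valueOn η.1.1) + quad Q (valueOn η.2.1) (valueOn η.2.1))

/-- `⟨A_h η, η'⟩ = (𝒜_σ σ, σ')_Q + (𝒜_ω ω, ω')_Q`. -/
def formA (m : Material) (Q : Rule) (η η' : V.X) : ℝ :=
  quad Q (fun T x => m.complS (valueOn η.1.1 T x)) (valueOn η'.1.1)
    + quad Q (fun T x => m.complW (valueOn η.2.1 T x)) (valueOn η'.2.1)

/-- `⟨B η, v⟩ = -(∇ ⋅ σ, u) + (asym σ, r) - (∇ ⋅ ℓ ω, r)`. -/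
def formB (Γn : Set (Pt d)) (ℓ : Pt d → ℝ) (η : V.X) (v : V.Y) : ℝ :=
  -⟪divS Γn η.1, toL2 v.1.1⟫_ℝ + ⟪asymL2 Ω (toL2 η.1.1), toL2 v.2.1⟫_ℝ
    - ⟪divW Γn ℓ η.2, toL2 v.2.1⟫_ℝ

/-- `p = (η, v) ∈ X_h × Y_h` solves the multipoint stress mixed finite element system with data
`g ∈ X_h'` and `f ∈ Y'`. -/
def IsSolution (m : Material) (Q : Rule) (Γn : Set (Pt d)) (ℓ : Pt d → ℝ)
    (g : V.X →ₗ[ℝ] ℝ) (f : SpaceY Ω →L[ℝ] ℝ) (p : V.X × V.Y) : Prop :=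
  ∀ (η' : V.X) (v' : V.Y),
    formA m Q p.1 η' - formB Γn ℓ η' p.2 + formB Γn ℓ p.1 v' = g η' + f (yL2 v')

end FESpaces

end

end Cosserat

/-! The system is a square finite-dimensional saddle-point problem, so an a priori bound gives
uniqueness (zero data force a zero solution), and uniqueness gives existence by equality of
dimensions (`existsUnique_of_forall_eq_zero`). Everything rests on the bound
`normX_add_norm_yL2_le`, obtained from four choices of test function.

Write `s` for the `L²` norm of the solution `η = (σ, ω)`, `G` and `F` for the norms of the data.
Testing with `η` itself and using `⟨Bη, v⟩ = f(v)` gives `a s² ≤ G ‖η‖_X + F ‖v‖`, with `a` from the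
coercivity of the material tensors and the lower quadrature bound. Testing with `u = -∇⋅σ`,
admissible since `∇⋅Σ_h ⊆ U_h`, gives `‖∇⋅σ‖ ≤ F`. Testing with `r = -Π_R ∇⋅(ℓω)` gives `‖Π_R
∇⋅(ℓω)‖ ≤ F + K s`, where `K` bounds `asym`. Elasticity stability with zero couple stress
(`exists_formB_ge`) gives `b ‖v‖ ≤ G + M s`. These close by a scalar quadratic inequality
(`energy_closing`).

The length scale never enters a constant: the inf-sup argument takes `ω = 0`, and `∇⋅(ℓω)` is
controlled only through its projection onto `R_h`, which is all that the test functions see and all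
that the norm contains.

Two facts make the norms and forms meaningful: piecewise polynomials are determined by their `L²`
class (`toL2_injective`), and weak divergences are unique (`IsWeakDiv.unique`), hence linear
although they are defined by choice. -/

namespace Cosserat

noncomputable section

open Tessellation

/-! ### Pointwise bounds for the material tensors -/

/-- The compliance as a linear map. -/
def complianceLM {d : ℕ} (μ μc lam : ℝ) : StressVal d →ₗ[ℝ] StressVal d where
  toFun := compliance μ μc lam
  map_add' a b := by
    ext ij
    simp only [compliance, PiLp.add_apply, Finset.sum_add_distrib]
    split_ifs <;> ring
  map_smul' c a := by
    ext ij
    simp only [compliance, PiLp.smul_apply, smul_eq_mul, RingHom.id_apply, ← Finset.mul_sum]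
    split_ifs <;> ring

/-- The stiffness as a linear map. -/
def stiffnessLM {d : ℕ} (μ μc lam : ℝ) : StressVal d →ₗ[ℝ] StressVal d where
  toFun := stiffness μ μc lam
  map_add' a b := by
    ext ij
    simp only [stiffness, PiLp.add_apply, Finset.sum_add_distrib]
    split_ifs <;> ring
  map_smul' c a := by
    ext ij
    simp only [stiffness, PiLp.smul_apply, smul_eq_mul, RingHom.id_apply, ← Finset.mul_sum]
    split_ifs <;> ring

/-- The stiffness is coercive for the Frobenius inner product. -/
theorem stiffness_coercive {d : ℕ} {μ μc lam : ℝ} (hl : 0 ≤ lam) (τ : StressVal d) :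
    2 * min μ μc * ‖τ‖ ^ 2 ≤ ⟪stiffness μ μc lam τ, τ⟫_ℝ := by
  -- Averaging the entries `(i, j)` and `(j, i)` turns the summand into `(μ (a + b)² + μc (a - b)²)
  -- / 2`, where `a`, `b` are the two entries, so the bound holds pair by pair.
  have hswap : ∀ F : Fin d → Fin d → ℝ, ∑ i, ∑ j, F i j = ∑ i, ∑ j, (F i j + F j i) / 2 := by
    intro F
    have h := Finset.sum_comm (s := Finset.univ) (t := Finset.univ) (f := F)
    simp only [← Finset.sum_div, Finset.sum_add_distrib]
    linarith
  have hin : ⟪stiffness μ μc lam τ, τ⟫_ℝ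
      = ∑ i, ∑ j, (2 * μ * ((τ (i, j) + τ (j, i)) / 2) * τ (i, j)
        + 2 * μc * ((τ (i, j) - τ (j, i)) / 2) * τ (i, j)) + lam * (∑ k, τ (k, k)) ^ 2 := by
    rw [PiLp.inner_apply, Fintype.sum_prod_type]
    have : lam * (∑ k, τ (k, k)) ^ 2
        = ∑ i, ∑ j, (if i = j then lam * ∑ k, τ (k, k) else 0) * τ (i, j) := by
      simp only [ite_mul, zero_mul, Finset.sum_ite_eq, Finset.mem_univ, if_true]
      rw [← Finset.mul_sum]; ring
    rw [this, ← Finset.sum_add_distrib]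
    refine Finset.sum_congr rfl fun i _ => ?_
    rw [← Finset.sum_add_distrib]
    refine Finset.sum_congr rfl fun j _ => ?_
    simp only [stiffness, RCLike.inner_apply, conj_trivial]
    ring
  have hn : 2 * min μ μc * ‖τ‖ ^ 2 = ∑ i, ∑ j, 2 * min μ μc * τ (i, j) ^ 2 := by
    rw [EuclideanSpace.norm_sq_eq, Fintype.sum_prod_type]
    simp only [Real.norm_eq_abs, sq_abs, Finset.mul_sum]
  rw [hin, hn, hswap, hswap fun i j => _ + _]
  have h0 : 0 ≤ lam * (∑ k, τ (k, k)) ^ 2 := by positivity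
  refine le_add_of_le_of_nonneg ?_ h0
  refine Finset.sum_le_sum fun i _ => Finset.sum_le_sum fun j _ => ?_
  have h1 : min μ μc * (τ (i, j) + τ (j, i)) ^ 2 ≤ μ * (τ (i, j) + τ (j, i)) ^ 2 :=
    mul_le_mul_of_nonneg_right (min_le_left _ _) (sq_nonneg _)
  have h2 : min μ μc * (τ (i, j) - τ (j, i)) ^ 2 ≤ μc * (τ (i, j) - τ (j, i)) ^ 2 :=
    mul_le_mul_of_nonneg_right (min_le_right _ _) (sq_nonneg _)
  nlinarith

/-- The compliance is coercive. -/
theorem exists_compliance_coercive {d : ℕ} {μ μc lam : ℝ} (hμ : 0 < μ) (hμc : 0 < μc)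
    (hl : 0 ≤ lam) :
    ∃ α : ℝ, 0 < α ∧ ∀ τ : StressVal d, α * ‖τ‖ ^ 2 ≤ ⟪compliance μ μc lam τ, τ⟫_ℝ := by
  obtain ⟨K, hK, hb⟩ := (LinearMap.toContinuousLinearMap (stiffnessLM (d := d) μ μc lam)).bound
  have hmin : 0 < min μ μc := lt_min hμ hμc
  -- With `χ` the compliance of `τ`, the pairing is that of `χ` with its own stiffness, at least `2
  -- min(μ, μc) ‖χ‖²`; and `‖τ‖ ≤ K ‖χ‖`.
  refine ⟨2 * min μ μc / K ^ 2, by positivity, fun τ => ?_⟩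
  have h1 := stiffness_coercive (μ := μ) (μc := μc) hl (compliance μ μc lam τ)
  have h2 := hb (compliance μ μc lam τ)
  change ‖stiffness μ μc lam _‖ ≤ _ at h2
  rw [stiffness_compliance hμ hμc hl] at h1 h2
  rw [real_inner_comm]
  refine le_trans ?_ h1
  have h3 : ‖τ‖ ^ 2 ≤ K ^ 2 * ‖compliance μ μc lam τ‖ ^ 2 := by
    rw [← mul_pow]; gcongr
  rw [div_mul_eq_mul_div, div_le_iff₀ (by positivity)]
  nlinarith

/-- The inverse material tensor of the couple stress as a linear map. -/
def Material.complWLM (m : Material) : {d : ℕ} → CoupleVal d →ₗ[ℝ] CoupleVal d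
  | 3 => complianceLM (d := 3) m.muW m.muWc m.lamW
  | _ => (1 / (2 * m.muW)) • LinearMap.id

theorem Material.complWLM_apply (m : Material) {d : ℕ} (hd : d = 2 ∨ d = 3) (τ : CoupleVal d) :
    m.complWLM τ = m.complW τ := by
  rcases hd with rfl | rfl <;> rfl

/-- The inverse material tensor of the Cauchy stress as a linear map. -/
def Material.complSLM (m : Material) {d : ℕ} : StressVal d →ₗ[ℝ] StressVal d :=
  complianceLM m.muS m.muSc m.lamS

theorem Material.exists_complS_coercive (m : Material) (d : ℕ) :
    ∃ α : ℝ, 0 < α ∧ ∀ τ : StressVal d, α * ‖τ‖ ^ 2 ≤ ⟪m.complSLM τ, τ⟫_ℝ :=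
  exists_compliance_coercive m.muS_pos m.muSc_pos m.lamS_nonneg

theorem Material.exists_complW_coercive (m : Material) {d : ℕ} (hd : d = 2 ∨ d = 3) :
    ∃ α : ℝ, 0 < α ∧ ∀ τ : CoupleVal d, α * ‖τ‖ ^ 2 ≤ ⟪m.complWLM τ, τ⟫_ℝ := by
  rcases hd with rfl | rfl
  · refine ⟨1 / (2 * m.muW), by have := m.muW_pos; positivity, fun τ => ?_⟩
    change _ ≤ ⟪(1 / (2 * m.muW)) • τ, τ⟫_ℝ
    rw [real_inner_smul_left, real_inner_self_eq_norm_sq]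
  · exact exists_compliance_coercive (d := 3) m.muW_pos m.muWc_pos m.lamW_nonneg

/-! ### Quadrature -/

namespace Tessellation

variable {d : ℕ} {Ω : Set (Pt d)} {𝒯 : Tessellation Ω}

/-- The nodes of both quadrature rules on an element: the center and the vertices. -/
def quadPoint (p : 𝒯.Elem × Option (Fin (d + 1))) : Pt d :=
  p.2.elim (𝒯.center p.1) (𝒯.node p.1)

/-- The weights of a quadrature rule. -/
def quadWeight (Q : Rule) (p : 𝒯.Elem × Option (Fin (d + 1))) : ℝ :=
  match Q, p.2 with
  | .Q1, none => 0
  | .Q1, some _ => 𝒯.vol p.1 / ((d : ℝ) + 1)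
  | .Q2, none => ((d : ℝ) + 1) / ((d : ℝ) + 2) * 𝒯.vol p.1
  | .Q2, some _ => 1 / ((d : ℝ) + 2) * (𝒯.vol p.1 / ((d : ℝ) + 1))

theorem quadWeight_nonneg (Q : Rule) (p : 𝒯.Elem × Option (Fin (d + 1))) :
    0 ≤ quadWeight Q p := by
  have hv : 0 ≤ 𝒯.vol p.1 := ENNReal.toReal_nonneg
  rcases p with ⟨T, _ | i⟩ <;> cases Q <;> simp only [quadWeight] <;> positivity

/-- A common form for both rules, the center having weight zero in `Q1`. With nonnegative weights,
pointwise bounds on the material tensors transfer to the quadrature forms. -/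
theorem quad_eq_sum {ι : Type} [Fintype ι] (Q : Rule)
    (F G : 𝒯.Elem → Pt d → EuclideanSpace ℝ ι) :
    quad Q F G = ∑ p : 𝒯.Elem × Option (Fin (d + 1)),
      quadWeight Q p * ⟪F p.1 (quadPoint p), G p.1 (quadPoint p)⟫_ℝ := by
  rw [Fintype.sum_prod_type]
  cases Q
  · simp only [quad, quad1, Fintype.sum_option, quadWeight, quadPoint, Option.elim, zero_mul,
      zero_add, Finset.mul_sum]
  · simp only [quad, quad1, Fintype.sum_option, quadWeight, quadPoint, Option.elim,
      Finset.mul_sum, mul_add, Finset.sum_add_distrib]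
    rw [add_comm]
    congr 1
    · exact Finset.sum_congr rfl fun T _ => by ring
    · exact Finset.sum_congr rfl fun T _ => Finset.sum_congr rfl fun i _ => by ring

/-! ### Piecewise polynomials are determined by their class in `L²` -/

theorem interior_cell_nonempty (T : 𝒯.Elem) : (interior (𝒯.cell T)).Nonempty := by
  rw [cell, interior_convexHull_nonempty_iff_affineSpan_eq_top,
    (𝒯.simplex T).independent.affineSpan_eq_top_iff_card_eq_finrank_add_one]
  simp

variable {k : ℕ} {ι : Type}

theorem valueOn_add (p q : 𝒯.PW k ι) (T : 𝒯.Elem) (x : Pt d) :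
    valueOn (p + q) T x = valueOn p T x + valueOn q T x := by
  ext i; simp [valueOn]

theorem valueOn_smul (c : ℝ) (p : 𝒯.PW k ι) (T : 𝒯.Elem) (x : Pt d) :
    valueOn (c • p) T x = c • valueOn p T x := by
  ext i; simp [valueOn]

theorem toFun_eq_valueOn (p : 𝒯.PW k ι) {T : 𝒯.Elem} {x : Pt d} (hx : x ∈ interior (𝒯.cell T)) :
    toFun p x = valueOn p T x := by
  rw [toFun, Finset.sum_eq_single T, Set.indicator_of_mem hx]
  · intro T' _ hT
    exact Set.indicator_of_notMem
      (fun hx' => Set.disjoint_left.1 (𝒯.disjoint_interior T' T hT) hx' hx) _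
  · simp

/-- An open set contains a product of open intervals, and a polynomial vanishing on a product of
infinite sets is zero. -/
theorem mvPolynomial_eq_zero_of_isOpen {p : MvPolynomial (Fin d) ℝ} {s : Set (Pt d)}
    (hs : IsOpen s) (hne : s.Nonempty) (h : ∀ x ∈ s, MvPolynomial.eval (fun j => x j) p = 0) :
    p = 0 := by
  obtain ⟨x, hx⟩ := hne
  have ho : IsOpen ((WithLp.toLp 2 : (Fin d → ℝ) → Pt d) ⁻¹' s) :=
    hs.preimage (PiLp.continuous_toLp 2 _)
  obtain ⟨ε, hε, hb⟩ := Metric.isOpen_iff.1 ho (fun j => x j) (by simpa using hx)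
  refine MvPolynomial.funext_set (fun j => Metric.ball (x j) ε) (fun j => ?_) fun y hy => ?_
  · rw [Real.ball_eq_Ioo]; exact Set.Ioo_infinite (by linarith)
  · rw [map_zero]
    refine h (WithLp.toLp 2 y) (hb ?_)
    rw [ball_pi _ hε]
    exact hy

/-- On the interior of an element, a continuous representative that vanishes almost everywhere
vanishes everywhere. This makes the discrete norms definite on coefficient spaces. -/
theorem toL2_injective [Fintype ι] : Function.Injective (toL2 : 𝒯.PW k ι →ₗ[ℝ] L2 Ω ι) := by
  rw [← LinearMap.ker_eq_bot, LinearMap.ker_eq_bot']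
  intro p hp
  have h0 : toFun p =ᵐ[volume.restrict Ω] 0 := by
    have h1 : toFun p =ᵐ[volume.restrict Ω] (memLp_toFun p).toLp := (memLp_toFun p).coeFn_toLp.symm
    have h2 : ((memLp_toFun p).toLp : L2 Ω ι) = 0 := hp
    rw [h2] at h1
    exact h1.trans (Lp.coeFn_zero _ _ _)
  ext T i : 3
  refine mvPolynomial_eq_zero_of_isOpen (isOpen_interior (s := 𝒯.cell T))
    (interior_cell_nonempty T) fun x hx => ?_
  have h1 : valueOn p T =ᵐ[volume.restrict (interior (𝒯.cell T))] 0 := by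
    filter_upwards [ae_restrict_of_ae_restrict_of_subset (𝒯.interior_subset T) h0,
      ae_restrict_mem isOpen_interior.measurableSet] with y hy hyT
    rw [← toFun_eq_valueOn p hyT, hy]
  have h2 := Measure.eqOn_open_of_ae_eq h1 isOpen_interior (continuous_valueOn p T).continuousOn
    continuousOn_const hx
  exact congrArg (fun v : EuclideanSpace ℝ ι => v i) h2

end Tessellation

/-! ### The weak divergence -/

section WeakDiv

variable {d : ℕ} {Ω Γn : Set (Pt d)} {ι : Type} [Fintype ι]

theorem IsTest.of_tsupport_subset (hΩ : IsOpen Ω) (hΓ : Γn ⊆ frontier Ω) {φ : Pt d → ℝ}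
    (h : ContDiff ℝ ∞ φ) (hc : HasCompactSupport φ) (hs : tsupport φ ⊆ Ω) : IsTest Γn φ := by
  refine ⟨h, hc, ?_⟩
  have : {x ∈ Γn | φ x ≠ 0} = ∅ := by
    ext x
    simp only [Set.mem_ofPred_eq, Set.mem_empty_iff_false, iff_false, not_and, not_not]
    intro hx
    by_contra hne
    have h1 : x ∈ Ω := hs (subset_tsupport _ hne)
    have h2 := hΓ hx
    rw [hΩ.frontier_eq] at h2
    exact h2.2 h1
  rw [this, measure_empty]

theorem integrable_coord_mul {f : Pt d → EuclideanSpace ℝ ι} (hf : MemLp f 2 (volume.restrict Ω))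
    {φ : Pt d → ℝ} (hφ : Continuous φ) (hc : HasCompactSupport φ) (i : ι) :
    Integrable (fun x => f x i * φ x) (volume.restrict Ω) := by
  have h1 : MemLp (fun x => f x i) 2 (volume.restrict Ω) :=
    (EuclideanSpace.proj (𝕜 := ℝ) i : EuclideanSpace ℝ ι →L[ℝ] ℝ).comp_memLp' hf
  have h2 : MemLp φ 2 (volume.restrict Ω) := (hφ.memLp_of_hasCompactSupport hc).restrict Ω
  exact h1.integrable_mul h2

theorem IsWeakDiv.add {f f' : Pt d → EuclideanSpace ℝ (ι × Fin d)} {g g' : L2 Ω ι}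
    (hf : MemLp f 2 (volume.restrict Ω)) (hf' : MemLp f' 2 (volume.restrict Ω))
    (h : IsWeakDiv Ω Γn f g) (h' : IsWeakDiv Ω Γn f' g') :
    IsWeakDiv Ω Γn (fun x => f x + f' x) (g + g') := by
  intro φ hφ i
  have hd : ∀ j, Continuous fun x => fderiv ℝ φ x (EuclideanSpace.single j 1) := fun j =>
    (hφ.1.continuous_fderiv (by simp)).clm_apply continuous_const
  have hdc : ∀ j, HasCompactSupport fun x => fderiv ℝ φ x (EuclideanSpace.single j 1) := fun j =>
    hφ.2.1.fderiv_apply (𝕜 := ℝ) _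
  have e1 : ∫ x in Ω, (g + g' : L2 Ω ι) x i * φ x = ∫ x in Ω, (g x i * φ x + g' x i * φ x) := by
    refine integral_congr_ae ?_
    filter_upwards [Lp.coeFn_add g g'] with x hx
    rw [hx]; simp [add_mul]
  rw [e1, integral_add (integrable_coord_mul (Lp.memLp g) hφ.1.continuous hφ.2.1 i)
    (integrable_coord_mul (Lp.memLp g') hφ.1.continuous hφ.2.1 i), neg_add, ← h φ hφ i,
    ← h' φ hφ i, ← integral_add]
  · simp only [PiLp.add_apply, add_mul, Finset.sum_add_distrib]
  · exact integrable_finsetSum _ fun j _ => integrable_coord_mul hf (hd j) (hdc j) _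
  · exact integrable_finsetSum _ fun j _ => integrable_coord_mul hf' (hd j) (hdc j) _

theorem IsWeakDiv.smul {f : Pt d → EuclideanSpace ℝ (ι × Fin d)} {g : L2 Ω ι} (c : ℝ)
    (h : IsWeakDiv Ω Γn f g) : IsWeakDiv Ω Γn (fun x => c • f x) (c • g) := by
  intro φ hφ i
  have e1 : ∫ x in Ω, (c • g : L2 Ω ι) x i * φ x = ∫ x in Ω, c * (g x i * φ x) := by
    refine integral_congr_ae ?_
    filter_upwards [Lp.coeFn_smul c g] with x hx
    rw [hx]; simp [mul_assoc]
  rw [e1, integral_const_mul, ← mul_neg, ← h φ hφ i, ← integral_const_mul]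
  simp only [PiLp.smul_apply, smul_eq_mul, Finset.mul_sum, mul_assoc]

theorem IsWeakDiv.congr {f f' : Pt d → EuclideanSpace ℝ (ι × Fin d)} {g : L2 Ω ι}
    (h : IsWeakDiv Ω Γn f g) (hff' : f =ᵐ[volume.restrict Ω] f') : IsWeakDiv Ω Γn f' g := by
  intro φ hφ i
  rw [← h φ hφ i]
  refine integral_congr_ae ?_
  filter_upwards [hff'] with x hx
  rw [hx]

/-- Test functions compactly supported in `Ω` are admissible, as they vanish on the boundary; they
already determine each component by the fundamental lemma of the calculus of variations. -/
theorem IsWeakDiv.unique (hΩ : IsOpen Ω) (hΓ : Γn ⊆ frontier Ω)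
    {f : Pt d → EuclideanSpace ℝ (ι × Fin d)} {g g' : L2 Ω ι} (h : IsWeakDiv Ω Γn f g)
    (h' : IsWeakDiv Ω Γn f g') : g = g' := by
  have key : ∀ i, ∀ᵐ x ∂(volume : Measure (Pt d)), x ∈ Ω → g x i - g' x i = 0 := by
    intro i
    have hm : MemLp (fun x => g x i - g' x i) 2 (volume.restrict Ω) :=
      ((EuclideanSpace.proj (𝕜 := ℝ) i : EuclideanSpace ℝ ι →L[ℝ] ℝ).comp_memLp' (Lp.memLp g)).sub
        ((EuclideanSpace.proj (𝕜 := ℝ) i : EuclideanSpace ℝ ι →L[ℝ] ℝ).comp_memLp' (Lp.memLp g'))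
    refine hΩ.ae_eq_zero_of_integral_contDiff_smul_eq_zero ?_ fun φ hφ hc hs => ?_
    · exact locallyIntegrableOn_of_locallyIntegrable_restrict
        (hm.locallyIntegrable one_le_two)
    · have ht := IsTest.of_tsupport_subset hΩ hΓ hφ hc hs
      have e : ∫ x in Ω, φ x • (g x i - g' x i) = 0 := by
        have e1 : ∀ x, φ x • (g x i - g' x i) = g x i * φ x - g' x i * φ x := fun x => by
          simp only [smul_eq_mul]; ring
        simp only [e1]
        rw [integral_sub (integrable_coord_mul (Lp.memLp g) hφ.continuous hc i)
          (integrable_coord_mul (Lp.memLp g') hφ.continuous hc i)]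
        linarith [h φ ht i, h' φ ht i]
      rw [← e, setIntegral_eq_integral_of_forall_compl_eq_zero]
      intro x hx
      have : φ x = 0 := by
        by_contra hne
        exact hx (hs (subset_tsupport _ hne))
      rw [this, zero_smul]
  refine Lp.ext ?_
  have hall : ∀ᵐ x ∂(volume : Measure (Pt d)), ∀ i, x ∈ Ω → g x i - g' x i = 0 :=
    ae_all_iff.2 key
  filter_upwards [ae_restrict_of_ae hall, ae_restrict_mem hΩ.measurableSet] with x hx hxΩ
  ext i
  linarith [hx i hxΩ]

theorem isWeakDiv_weakDiv {f : Pt d → EuclideanSpace ℝ (ι × Fin d)}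
    (h : ∃ g : L2 Ω ι, IsWeakDiv Ω Γn f g) : IsWeakDiv Ω Γn f (weakDiv Ω Γn f) := by
  rw [weakDiv, dif_pos h]
  exact h.choose_spec

/-- Essential boundedness of `ℓ` supplies the integrability needed to add weak divergences of `ℓω`;
its size enters no estimate. -/
theorem IsLengthScale.memLp_smul {ℓ : Pt d → ℝ} (hΩ : IsOpen Ω) (hℓ : IsLengthScale Ω ℓ)
    {f : Pt d → EuclideanSpace ℝ ι} (hf : MemLp f 2 (volume.restrict Ω)) :
    MemLp (fun x => ℓ x • f x) 2 (volume.restrict Ω) := by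
  obtain ⟨hc, -, M, G, -, hb, -⟩ := hℓ
  have hm : AEStronglyMeasurable ℓ (volume.restrict Ω) :=
    hc.aestronglyMeasurable hΩ.measurableSet
  refine MemLp.of_le_mul (c := M) hf (hm.smul hf.1) ?_
  filter_upwards [hb] with x hx
  rw [norm_smul, Real.norm_eq_abs]
  exact mul_le_mul_of_nonneg_right hx.1 (norm_nonneg _)

end WeakDiv

namespace FESpaces

variable {d : ℕ} {Ω Γn : Set (Pt d)} {𝒯 : Tessellation Ω} {V : FESpaces 𝒯} {ℓ : Pt d → ℝ}

/-! ### Linearity of the discrete divergences -/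

theorem divS_add (hΩ : IsOpen Ω) (hΓ : Γn ⊆ frontier Ω) (hV : V.Conforming Γn ℓ)
    (σ σ' : V.S) : divS Γn (σ + σ') = divS Γn σ + divS Γn σ' := by
  have h := isWeakDiv_weakDiv (hV.1 _ σ.2)
  have h' := isWeakDiv_weakDiv (hV.1 _ σ'.2)
  refine (isWeakDiv_weakDiv (hV.1 _ (σ + σ').2)).unique hΩ hΓ
    ((h.add (Lp.memLp _) (Lp.memLp _) h').congr ?_)
  rw [Submodule.coe_add, map_add]
  exact (Lp.coeFn_add _ _).symm

theorem divS_smul (hΩ : IsOpen Ω) (hΓ : Γn ⊆ frontier Ω) (hV : V.Conforming Γn ℓ)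
    (c : ℝ) (σ : V.S) : divS Γn (c • σ) = c • divS Γn σ := by
  have h := isWeakDiv_weakDiv (hV.1 _ σ.2)
  refine (isWeakDiv_weakDiv (hV.1 _ (c • σ).2)).unique hΩ hΓ ((h.smul c).congr ?_)
  rw [Submodule.coe_smul, map_smul]
  exact (Lp.coeFn_smul c (toL2 (Ω := Ω) σ.1)).symm

theorem divW_add (hΩ : IsOpen Ω) (hΓ : Γn ⊆ frontier Ω) (hV : V.Conforming Γn ℓ)
    (hℓ : IsLengthScale Ω ℓ) (w w' : V.W) :
    divW Γn ℓ (w + w') = divW Γn ℓ w + divW Γn ℓ w' := by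
  have h := isWeakDiv_weakDiv (hV.2 _ w.2)
  have h' := isWeakDiv_weakDiv (hV.2 _ w'.2)
  refine (isWeakDiv_weakDiv (hV.2 _ (w + w').2)).unique hΩ hΓ
    ((h.add (hℓ.memLp_smul hΩ (Lp.memLp _)) (hℓ.memLp_smul hΩ (Lp.memLp _)) h').congr ?_)
  rw [Submodule.coe_add, map_add]
  filter_upwards [Lp.coeFn_add (toL2 (Ω := Ω) w.1) (toL2 w'.1)] with x hx
  rw [hx, Pi.add_apply, smul_add]

theorem divW_smul (hΩ : IsOpen Ω) (hΓ : Γn ⊆ frontier Ω) (hV : V.Conforming Γn ℓ)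
    (c : ℝ) (w : V.W) : divW Γn ℓ (c • w) = c • divW Γn ℓ w := by
  have h := isWeakDiv_weakDiv (hV.2 _ w.2)
  refine (isWeakDiv_weakDiv (hV.2 _ (c • w).2)).unique hΩ hΓ ((h.smul c).congr ?_)
  rw [Submodule.coe_smul, map_smul]
  filter_upwards [Lp.coeFn_smul c (toL2 (Ω := Ω) w.1)] with x hx
  rw [hx, Pi.smul_apply, smul_comm]

/-! ### The bilinear form `A_h` -/

theorem formA_eq_sum (m : Material) (hd : d = 2 ∨ d = 3) (Q : Rule) (η η' : V.X) :
    formA m Q η η' = ∑ p : 𝒯.Elem × Option (Fin (d + 1)), quadWeight Q p *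
      (⟪m.complSLM (valueOn η.1.1 p.1 (quadPoint p)), valueOn η'.1.1 p.1 (quadPoint p)⟫_ℝ
        + ⟪m.complWLM (valueOn η.2.1 p.1 (quadPoint p)),
            valueOn η'.2.1 p.1 (quadPoint p)⟫_ℝ) := by
  rw [formA, quad_eq_sum, quad_eq_sum, ← Finset.sum_add_distrib]
  refine Finset.sum_congr rfl fun p _ => ?_
  rw [mul_add, m.complWLM_apply hd]
  rfl

theorem normQ_sq (Q : Rule) (η : V.X) :
    normQ Q η ^ 2 = ∑ p : 𝒯.Elem × Option (Fin (d + 1)), quadWeight Q p *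
      (‖valueOn η.1.1 p.1 (quadPoint p)‖ ^ 2 + ‖valueOn η.2.1 p.1 (quadPoint p)‖ ^ 2) := by
  have h : quad Q (valueOn η.1.1) (valueOn η.1.1) + quad Q (valueOn η.2.1) (valueOn η.2.1)
      = ∑ p : 𝒯.Elem × Option (Fin (d + 1)), quadWeight Q p *
      (‖valueOn η.1.1 p.1 (quadPoint p)‖ ^ 2 + ‖valueOn η.2.1 p.1 (quadPoint p)‖ ^ 2) := by
    rw [quad_eq_sum, quad_eq_sum, ← Finset.sum_add_distrib]
    refine Finset.sum_congr rfl fun p _ => ?_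
    rw [mul_add, real_inner_self_eq_norm_sq, real_inner_self_eq_norm_sq]
  rw [normQ, h, Real.sq_sqrt]
  exact Finset.sum_nonneg fun p _ => mul_nonneg (quadWeight_nonneg Q p) (by positivity)

theorem formA_coercive {m : Material} (hd : d = 2 ∨ d = 3) {α : ℝ}
    (hS : ∀ τ : StressVal d, α * ‖τ‖ ^ 2 ≤ ⟪m.complSLM τ, τ⟫_ℝ)
    (hW : ∀ τ : CoupleVal d, α * ‖τ‖ ^ 2 ≤ ⟪m.complWLM τ, τ⟫_ℝ) (Q : Rule) (η : V.X) :
    α * normQ Q η ^ 2 ≤ formA m Q η η := by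
  rw [formA_eq_sum m hd, normQ_sq, Finset.mul_sum]
  refine Finset.sum_le_sum fun p _ => ?_
  rw [mul_left_comm, mul_add]
  exact mul_le_mul_of_nonneg_left (add_le_add (hS _) (hW _)) (quadWeight_nonneg Q p)

/-- Cauchy–Schwarz by the discriminant: at each node `‖s z + y‖² ≥ 0`, with `z` the compliance of
the value of `η` and `y` the value of `η'`. Replacing `‖z‖²` by its upper bound and summing gives a
nonnegative quadratic in `s`. -/
theorem abs_formA_le {m : Material} (hd : d = 2 ∨ d = 3) {M : ℝ} (hM : 0 ≤ M)
    (hS : ∀ τ : StressVal d, ‖m.complSLM τ‖ ≤ M * ‖τ‖)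
    (hW : ∀ τ : CoupleVal d, ‖m.complWLM τ‖ ≤ M * ‖τ‖) (Q : Rule) (η η' : V.X) :
    |formA m Q η η'| ≤ M * normQ Q η * normQ Q η' := by
  have key : ∀ {E : Type} [NormedAddCommGroup E] [InnerProductSpace ℝ E] (x y z : E) (s : ℝ),
      ‖z‖ ≤ M * ‖x‖ → 0 ≤ M ^ 2 * ‖x‖ ^ 2 * (s * s) + 2 * ⟪z, y⟫_ℝ * s + ‖y‖ ^ 2 := by
    intro E _ _ x y z s h
    have h1 : ‖z‖ ^ 2 ≤ M ^ 2 * ‖x‖ ^ 2 := by rw [← mul_pow]; gcongr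
    have h2 : 0 ≤ ‖s • z + y‖ ^ 2 := sq_nonneg _
    rw [norm_add_sq_real, norm_smul, real_inner_smul_left, mul_pow, Real.norm_eq_abs, sq_abs] at h2
    nlinarith [mul_le_mul_of_nonneg_left h1 (mul_self_nonneg s)]
  have hq : ∀ s : ℝ, 0 ≤ (M ^ 2 * normQ Q η ^ 2) * (s * s) + (2 * formA m Q η η') * s
      + normQ Q η' ^ 2 := by
    intro s
    rw [formA_eq_sum m hd, normQ_sq, normQ_sq, Finset.mul_sum, Finset.mul_sum, Finset.sum_mul,
      Finset.sum_mul, ← Finset.sum_add_distrib, ← Finset.sum_add_distrib]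
    refine Finset.sum_nonneg fun p _ => ?_
    have h1 := mul_nonneg (quadWeight_nonneg Q p) (add_nonneg
      (key _ (valueOn η'.1.1 p.1 (quadPoint p)) _ s (hS (valueOn η.1.1 p.1 (quadPoint p))))
      (key _ (valueOn η'.2.1 p.1 (quadPoint p)) _ s (hW (valueOn η.2.1 p.1 (quadPoint p)))))
    refine h1.trans_eq ?_
    ring
  have hdisc := discrim_le_zero hq
  rw [discrim] at hdisc
  refine abs_le_of_sq_le_sq ?_ ?_
  · nlinarith
  · exact mul_nonneg (mul_nonneg hM (Real.sqrt_nonneg _)) (Real.sqrt_nonneg _)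

/-! ### Norms on the discrete spaces -/

theorem norm_yL2_sq (v : V.Y) :
    ‖yL2 v‖ ^ 2 = ‖toL2 (Ω := Ω) v.1.1‖ ^ 2 + ‖toL2 (Ω := Ω) v.2.1‖ ^ 2 := by
  rw [yL2, WithLp.prod_norm_sq_eq_of_L2]
  rfl

theorem norm_yL2_le_add (v : V.Y) :
    ‖yL2 v‖ ≤ ‖toL2 (Ω := Ω) v.1.1‖ + ‖toL2 (Ω := Ω) v.2.1‖ := by
  refine le_of_sq_le_sq ?_ (by positivity)
  rw [norm_yL2_sq]
  nlinarith [norm_nonneg (toL2 (Ω := Ω) v.1.1), norm_nonneg (toL2 (Ω := Ω) v.2.1)]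

theorem yL2_add (v v' : V.Y) : yL2 (v + v') = yL2 v + yL2 v' := by
  simp only [yL2, Prod.fst_add, Prod.snd_add, Submodule.coe_add, map_add]
  rfl

theorem yL2_smul (c : ℝ) (v : V.Y) : yL2 (c • v) = c • yL2 v := by
  simp only [yL2, Prod.smul_fst, Prod.smul_snd, Submodule.coe_smul, map_smul]
  rfl

theorem eq_zero_of_norm_yL2_eq_zero {v : V.Y} (h : ‖yL2 v‖ = 0) : v = 0 := by
  have h1 := norm_yL2_sq v
  rw [h] at h1
  have hu : ‖toL2 (Ω := Ω) v.1.1‖ = 0 := by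
    nlinarith [sq_nonneg ‖toL2 (Ω := Ω) v.1.1‖, sq_nonneg ‖toL2 (Ω := Ω) v.2.1‖]
  have hr : ‖toL2 (Ω := Ω) v.2.1‖ = 0 := by
    nlinarith [sq_nonneg ‖toL2 (Ω := Ω) v.1.1‖, sq_nonneg ‖toL2 (Ω := Ω) v.2.1‖]
  refine Prod.ext (Subtype.ext (toL2_injective ?_)) (Subtype.ext (toL2_injective ?_))
  · rw [norm_eq_zero.1 hu]; exact (map_zero _).symm
  · rw [norm_eq_zero.1 hr]; exact (map_zero _).symm

theorem normX_nonneg (η : V.X) : 0 ≤ normX Γn ℓ η := Real.sqrt_nonneg _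

theorem normL2_le_normX (η : V.X) : normL2 η ≤ normX Γn ℓ η := by
  refine Real.sqrt_le_sqrt ?_
  nlinarith [sq_nonneg ‖divS Γn η.1‖, sq_nonneg ‖V.RL2.starProjection (divW Γn ℓ η.2)‖]

theorem norm_fst_le_normL2 (η : V.X) : ‖toL2 (Ω := Ω) η.1.1‖ ≤ normL2 η :=
  Real.le_sqrt_of_sq_le (by nlinarith [sq_nonneg ‖toL2 (Ω := Ω) η.2.1‖])

theorem norm_snd_le_normL2 (η : V.X) : ‖toL2 (Ω := Ω) η.2.1‖ ≤ normL2 η :=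
  Real.le_sqrt_of_sq_le (by nlinarith [sq_nonneg ‖toL2 (Ω := Ω) η.1.1‖])

theorem normX_le_add (η : V.X) :
    normX Γn ℓ η ≤ normL2 η + ‖divS Γn η.1‖ + ‖V.RL2.starProjection (divW Γn ℓ η.2)‖ := by
  have h0 : 0 ≤ normL2 η := Real.sqrt_nonneg _
  have h1 : normL2 η ^ 2 = ‖toL2 (Ω := Ω) η.1.1‖ ^ 2 + ‖toL2 (Ω := Ω) η.2.1‖ ^ 2 :=
    Real.sq_sqrt (by positivity)
  refine (Real.sqrt_le_iff).2 ⟨by positivity, ?_⟩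
  have h2 := norm_nonneg (divS Γn η.1)
  have h3 := norm_nonneg (V.RL2.starProjection (divW Γn ℓ η.2))
  nlinarith [mul_nonneg h0 h2, mul_nonneg h0 h3, mul_nonneg h2 h3]

theorem eq_zero_of_normL2_eq_zero {η : V.X} (h : normL2 η = 0) : η = 0 := by
  have hs : ‖toL2 (Ω := Ω) η.1.1‖ = 0 :=
    le_antisymm ((norm_fst_le_normL2 η).trans_eq h) (norm_nonneg _)
  have hw : ‖toL2 (Ω := Ω) η.2.1‖ = 0 :=
    le_antisymm ((norm_snd_le_normL2 η).trans_eq h) (norm_nonneg _)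
  refine Prod.ext (Subtype.ext (toL2_injective ?_)) (Subtype.ext (toL2_injective ?_))
  · rw [norm_eq_zero.1 hs]; exact (map_zero _).symm
  · rw [norm_eq_zero.1 hw]; exact (map_zero _).symm

theorem eq_zero_of_normX_eq_zero {η : V.X} (h : normX Γn ℓ η = 0) : η = 0 :=
  eq_zero_of_normL2_eq_zero
    (le_antisymm ((normL2_le_normX (Γn := Γn) (ℓ := ℓ) η).trans_eq h) (Real.sqrt_nonneg _))

instance : FiniteDimensional ℝ V.X := by unfold X; infer_instance

instance : FiniteDimensional ℝ V.Y := by unfold Y; infer_instance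

/-- The embedding of `X_h` into `L² × L²`. -/
def xL2 : V.X →ₗ[ℝ] L2 Ω (Fin d × Fin d) × L2 Ω (Fin (d.choose 2) × Fin d) :=
  (toL2.comp V.S.subtype).prodMap (toL2.comp V.W.subtype)

theorem xL2_injective : Function.Injective (xL2 : V.X →ₗ[ℝ] _) := by
  intro η η' h
  have h1 := congrArg Prod.fst h
  have h2 := congrArg Prod.snd h
  exact Prod.ext (Subtype.ext (toL2_injective h1)) (Subtype.ext (toL2_injective h2))

/-- A real supremum of an unbounded set is `0` by convention, so boundedness must be known before
the dual norm can be used. It holds because every functional on the finite-dimensional image of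
`X_h` in `L² × L²` is continuous. -/
theorem bddAbove_dualNormX (g : V.X →ₗ[ℝ] ℝ) :
    BddAbove (Set.range fun η : V.X => g η / normX Γn ℓ η) := by
  let e := LinearEquiv.ofInjective (xL2 : V.X →ₗ[ℝ] _) xL2_injective
  let g' := LinearMap.toContinuousLinearMap (g.comp e.symm.toLinearMap)
  have hg' : 0 ≤ ‖g'‖ := norm_nonneg g'
  refine ⟨‖g'‖, ?_⟩
  rintro _ ⟨η, rfl⟩
  refine div_le_of_le_mul₀ (normX_nonneg η) hg' ?_
  have h1 : g η = g' (e η) := by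
    change g η = g (e.symm (e η))
    rw [e.symm_apply_apply]
  have h2 : ‖e η‖ ≤ normL2 η := max_le (norm_fst_le_normL2 η) (norm_snd_le_normL2 η)
  rw [h1]
  refine (le_abs_self _).trans ((g'.le_opNorm _).trans ?_)
  exact mul_le_mul_of_nonneg_left (h2.trans (normL2_le_normX η)) hg'

theorem dualNormX_nonneg (g : V.X →ₗ[ℝ] ℝ) : 0 ≤ dualNormX Γn ℓ g := by
  -- At `η = 0` the quotient is `0 / 0 = 0`.
  refine le_trans ?_ (le_ciSup (bddAbove_dualNormX g) 0)
  simp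

theorem le_dualNormX_mul (g : V.X →ₗ[ℝ] ℝ) (η : V.X) :
    g η ≤ dualNormX Γn ℓ g * normX Γn ℓ η := by
  rcases (normX_nonneg (Γn := Γn) (ℓ := ℓ) η).eq_or_lt with h | h
  · rw [eq_zero_of_normX_eq_zero h.symm, map_zero]
    exact mul_nonneg (dualNormX_nonneg g) (normX_nonneg _)
  · rw [← div_le_iff₀ h]
    exact le_ciSup (bddAbove_dualNormX g) η

/-! ### The discrete system -/

theorem formA_add_left (m : Material) (hd : d = 2 ∨ d = 3) (Q : Rule) (η₁ η₂ η' : V.X) :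
    formA m Q (η₁ + η₂) η' = formA m Q η₁ η' + formA m Q η₂ η' := by
  simp only [formA_eq_sum m hd, ← Finset.sum_add_distrib]
  refine Finset.sum_congr rfl fun p _ => ?_
  simp only [Prod.fst_add, Prod.snd_add, Submodule.coe_add, valueOn_add, map_add, inner_add_left]
  ring

theorem formA_smul_left (m : Material) (hd : d = 2 ∨ d = 3) (Q : Rule) (c : ℝ) (η η' : V.X) :
    formA m Q (c • η) η' = c * formA m Q η η' := by
  simp only [formA_eq_sum m hd, Finset.mul_sum]
  refine Finset.sum_congr rfl fun p _ => ?_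
  simp only [Prod.smul_fst, Prod.smul_snd, Submodule.coe_smul, valueOn_smul, map_smul,
    real_inner_smul_left]
  ring

theorem formA_add_right (m : Material) (hd : d = 2 ∨ d = 3) (Q : Rule) (η η₁ η₂ : V.X) :
    formA m Q η (η₁ + η₂) = formA m Q η η₁ + formA m Q η η₂ := by
  simp only [formA_eq_sum m hd, ← Finset.sum_add_distrib]
  refine Finset.sum_congr rfl fun p _ => ?_
  simp only [Prod.fst_add, Prod.snd_add, Submodule.coe_add, valueOn_add, inner_add_right]
  ring

theorem formA_smul_right (m : Material) (hd : d = 2 ∨ d = 3) (Q : Rule) (c : ℝ) (η η' : V.X) :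
    formA m Q η (c • η') = c * formA m Q η η' := by
  simp only [formA_eq_sum m hd, Finset.mul_sum]
  refine Finset.sum_congr rfl fun p _ => ?_
  simp only [Prod.smul_fst, Prod.smul_snd, Submodule.coe_smul, valueOn_smul,
    real_inner_smul_right]
  ring

theorem formB_add_left (hΩ : IsOpen Ω) (hΓ : Γn ⊆ frontier Ω) (hV : V.Conforming Γn ℓ)
    (hℓ : IsLengthScale Ω ℓ) (η₁ η₂ : V.X) (v : V.Y) :
    formB Γn ℓ (η₁ + η₂) v = formB Γn ℓ η₁ v + formB Γn ℓ η₂ v := by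
  simp only [formB, Prod.fst_add, Prod.snd_add, Submodule.coe_add, divS_add hΩ hΓ hV,
    divW_add hΩ hΓ hV hℓ, map_add, inner_add_left]
  ring

theorem formB_smul_left (hΩ : IsOpen Ω) (hΓ : Γn ⊆ frontier Ω) (hV : V.Conforming Γn ℓ)
    (c : ℝ) (η : V.X) (v : V.Y) : formB Γn ℓ (c • η) v = c * formB Γn ℓ η v := by
  simp only [formB, Prod.smul_fst, Prod.smul_snd, Submodule.coe_smul, divS_smul hΩ hΓ hV,
    divW_smul hΩ hΓ hV, map_smul, real_inner_smul_left]
  ring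

theorem formB_add_right (η : V.X) (v₁ v₂ : V.Y) :
    formB Γn ℓ η (v₁ + v₂) = formB Γn ℓ η v₁ + formB Γn ℓ η v₂ := by
  simp only [formB, Prod.fst_add, Prod.snd_add, Submodule.coe_add, map_add, inner_add_right]
  ring

theorem formB_smul_right (c : ℝ) (η : V.X) (v : V.Y) :
    formB Γn ℓ η (c • v) = c * formB Γn ℓ η v := by
  simp only [formB, Prod.smul_fst, Prod.smul_snd, Submodule.coe_smul, map_smul,
    real_inner_smul_right]
  ring

/-- The bilinear form of the discrete system on `X_h × Y_h`. -/
def systemForm (m : Material) (hd : d = 2 ∨ d = 3) (Q : Rule) (hΩ : IsOpen Ω)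
    (hΓ : Γn ⊆ frontier Ω) (hV : V.Conforming Γn ℓ) (hℓ : IsLengthScale Ω ℓ) :
    (V.X × V.Y) →ₗ[ℝ] (V.X × V.Y) →ₗ[ℝ] ℝ :=
  LinearMap.mk₂ ℝ
    (fun p q => formA m Q p.1 q.1 - formB Γn ℓ q.1 p.2 + formB Γn ℓ p.1 q.2)
    (fun p p' q => by
      simp only [Prod.fst_add, Prod.snd_add, formA_add_left m hd, formB_add_right,
        formB_add_left hΩ hΓ hV hℓ]
      ring)
    (fun c p q => by
      simp only [Prod.smul_fst, Prod.smul_snd, formA_smul_left m hd, formB_smul_right,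
        formB_smul_left hΩ hΓ hV, smul_eq_mul]
      ring)
    (fun p q q' => by
      simp only [Prod.fst_add, Prod.snd_add, formA_add_right m hd, formB_add_right,
        formB_add_left hΩ hΓ hV hℓ]
      ring)
    (fun c p q => by
      simp only [Prod.smul_fst, Prod.smul_snd, formA_smul_right m hd, formB_smul_right,
        formB_smul_left hΩ hΓ hV, smul_eq_mul]
      ring)

/-- The right-hand side of the discrete system as a linear functional on `X_h × Y_h`. -/
def systemData (g : V.X →ₗ[ℝ] ℝ) (f : SpaceY Ω →L[ℝ] ℝ) : (V.X × V.Y) →ₗ[ℝ] ℝ where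
  toFun q := g q.1 + f (yL2 q.2)
  map_add' q q' := by
    simp only [Prod.fst_add, Prod.snd_add, yL2_add, map_add]; ring
  map_smul' c q := by
    simp only [Prod.smul_fst, Prod.smul_snd, yL2_smul, map_smul, smul_eq_mul, RingHom.id_apply]
    ring

theorem isSolution_iff (m : Material) (hd : d = 2 ∨ d = 3) (Q : Rule) (hΩ : IsOpen Ω)
    (hΓ : Γn ⊆ frontier Ω) (hV : V.Conforming Γn ℓ) (hℓ : IsLengthScale Ω ℓ)
    (g : V.X →ₗ[ℝ] ℝ) (f : SpaceY Ω →L[ℝ] ℝ) (p : V.X × V.Y) :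
    IsSolution m Q Γn ℓ g f p ↔ systemForm m hd Q hΩ hΓ hV hℓ p = systemData g f :=
  ⟨fun h => LinearMap.ext fun q => h q.1 q.2, fun h η' v' => LinearMap.congr_fun h (η', v')⟩

/-- A space and its dual have the same finite dimension, so an injective map between them is onto.
-/
theorem existsUnique_of_forall_eq_zero {E : Type*} [AddCommGroup E] [Module ℝ E]
    [FiniteDimensional ℝ E] (B : E →ₗ[ℝ] E →ₗ[ℝ] ℝ) (hB : ∀ p, B p = 0 → p = 0)
    (F : E →ₗ[ℝ] ℝ) : ∃! p, B p = F := by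
  have hinj : Function.Injective B := by
    rw [← LinearMap.ker_eq_bot, LinearMap.ker_eq_bot']
    exact hB
  have hsurj : Function.Surjective B :=
    (LinearMap.injective_iff_surjective_of_finrank_eq_finrank
      Subspace.dual_finrank_eq.symm).1 hinj
  obtain ⟨p, hp⟩ := hsurj F
  exact ⟨p, hp, fun q hq => hinj (hq.trans hp.symm)⟩

/-! ### The a priori estimate -/

/-- The inf-sup condition for the form `B`, with the couple stress set to zero. -/
theorem exists_formB_ge (hΩ : IsOpen Ω) (hΓ : Γn ⊆ frontier Ω) (hV : V.Conforming Γn ℓ)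
    {β : ℝ} (hβ : 0 < β) (hs : V.ElasticityStable Γn β) {v : V.Y} (hv : v ≠ 0) :
    ∃ η : V.X, 0 < normX Γn ℓ η ∧ β / 2 * ‖yL2 v‖ * normX Γn ℓ η ≤ -formB Γn ℓ η v := by
  -- For `ω = 0`, `-B` carries the asymmetry term with a minus sign, so stability is applied to `(u,
  -- -r)`.
  have hv' : ((v.1, -v.2) : V.Y) ≠ 0 := by
    intro h
    have h' := Prod.mk_eq_zero.1 h
    exact hv (Prod.ext h'.1 ((neg_eq_zero (a := v.2)).1 h'.2))
  -- Settling for `β / 2` yields an actual `σ` without asking whether the supremum is attained.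
  obtain ⟨σ, hσ⟩ := exists_lt_of_lt_ciSup (lt_of_lt_of_le (half_lt_self hβ) (hs _ hv'))
  have hdW : divW Γn ℓ (0 : V.W) = 0 := by
    have := divW_smul hΩ hΓ hV 0 (0 : V.W)
    rwa [zero_smul, zero_smul] at this
  have hnX : normX Γn ℓ ((σ, 0) : V.X) = √(‖toL2 (Ω := Ω) σ.1‖ ^ 2 + ‖divS Γn σ‖ ^ 2) := by
    simp [normX, hdW]
  have hnY : ‖yL2 ((v.1, -v.2) : V.Y)‖ = ‖yL2 v‖ := by
    rw [← sq_eq_sq₀ (norm_nonneg _) (norm_nonneg _), norm_yL2_sq, norm_yL2_sq]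
    simp
  rw [← hnX, hnY] at hσ
  -- A vanishing denominator would make the quotient `0`, which does not exceed `β / 2`.
  have hpos : 0 < normX Γn ℓ ((σ, 0) : V.X) * ‖yL2 v‖ := by
    refine lt_of_le_of_ne (mul_nonneg (normX_nonneg _) (norm_nonneg _)) fun h => ?_
    rw [← h, div_zero] at hσ
    linarith
  refine ⟨(σ, 0), pos_of_mul_pos_left hpos (norm_nonneg _), ?_⟩
  rw [lt_div_iff₀ hpos] at hσ
  have hB : -formB Γn ℓ ((σ, 0) : V.X) v = ⟪divS Γn σ, toL2 v.1.1⟫_ℝ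
      + ⟪asymL2 Ω (toL2 σ.1), toL2 (-v.2 : V.R).1⟫_ℝ := by
    simp only [formB, hdW, inner_zero_left, Submodule.coe_neg, map_neg, inner_neg_right]
    ring
  rw [hB]
  refine le_of_eq_of_le ?_ hσ.le
  ring

/-- The operator norm of the pointwise map serves for all `Ω` at once. -/
theorem norm_asymL2_le (d : ℕ) : ∃ K : ℝ, 0 ≤ K ∧ ∀ (Ω : Set (Pt d)) (σ : L2 Ω (Fin d × Fin d)),
    ‖asymL2 Ω σ‖ ≤ K * ‖σ‖ :=
  ⟨‖LinearMap.toContinuousLinearMap (asym d)‖, norm_nonneg _, fun _ σ =>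
    ((LinearMap.toContinuousLinearMap (asym d)).norm_compLp_le σ)⟩

/-- The constant of the a priori estimate, in terms of the coercivity constant `a`, half of the
inf-sup constant `b`, and the bounds `K` and `M` for the asymmetry operator and the form `A_h`. -/
def stabilityConst (a b K M : ℝ) : ℝ :=
  (1 + K + M / b) * ((3 + K + (1 + M) / b) / a + 1) + 2 + 1 / b

theorem stabilityConst_pos {a b K M : ℝ} (ha : 0 < a) (hb : 0 < b) (hK : 0 ≤ K) (hM : 0 ≤ M) :
    0 < stabilityConst a b K M := by
  unfold stabilityConst; positivity

/-- The elementary inequality that closes the a priori estimate. -/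
theorem energy_closing {a b K M s D P y N G F : ℝ} (ha : 0 < a) (hb : 0 < b) (hK : 0 ≤ K)
    (hM : 0 ≤ M) (hs : 0 ≤ s) (hG : 0 ≤ G) (hF : 0 ≤ F)
    (h1 : a * s ^ 2 ≤ G * N + F * y) (h2 : D ≤ F) (h3 : P ≤ F + K * s)
    (h4 : b * y ≤ G + M * s) (h5 : N ≤ s + D + P) :
    N + y ≤ stabilityConst a b K M * (G + F) := by
  unfold stabilityConst
  set E := G + F with hE
  set L := 3 + K + (1 + M) / b with hL
  have hEG : G ≤ E := by linarith
  have hEF : F ≤ E := by linarith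
  have hE0 : 0 ≤ E := by linarith
  have hy : y ≤ 1 / b * E + M / b * s := by
    have : y ≤ (G + M * s) / b := by rw [le_div_iff₀ hb]; linarith
    refine this.trans ?_
    rw [add_div, mul_div_right_comm, div_eq_mul_one_div G, mul_comm G]
    gcongr
  have hN : N ≤ (1 + K) * s + 2 * E := by linarith
  have hMb : 0 ≤ M / b := by positivity
  have hb' : 0 ≤ 1 / b := by positivity
  have hLs : (1 + M) / b = 1 / b + M / b := by ring
  have hL0 : 0 ≤ L := by positivity
  -- Substituting for `N` and `y` gives the coefficient `1 + K + M / b` of `E s` and `2 + 1 / b` of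
  -- `E²`; `L` is their sum and dominates both.
  have hquad : a * s ^ 2 ≤ L * E * s + L * E ^ 2 := by
    have e1 : G * N ≤ E * ((1 + K) * s + 2 * E) :=
      (mul_le_mul_of_nonneg_left hN hG).trans (mul_le_mul_of_nonneg_right hEG (by positivity))
    have e2 : F * y ≤ E * (1 / b * E + M / b * s) :=
      (mul_le_mul_of_nonneg_left hy hF).trans (mul_le_mul_of_nonneg_right hEF (by positivity))
    have e3 : 0 ≤ E * s := by positivity
    have e4 : 0 ≤ E ^ 2 := by positivity
    have e5 : 0 ≤ M / b * E ^ 2 := by positivity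
    have e6 : 0 ≤ 1 / b * (E * s) := by positivity
    have e7 : 0 ≤ K * E ^ 2 := by positivity
    rw [hL, hLs]
    nlinarith
  have hsE : s ≤ (L / a + 1) * E := by
    -- Otherwise `a s² > L E s + a E s`, while `L E ≤ a s` bounds the right side of `hquad` by `L E
    -- s + a E s`.
    by_contra! hcon
    have hLa : 0 ≤ L / a := by positivity
    have e0 : E ≤ s := by nlinarith
    have e1 : 0 < s := lt_of_le_of_lt (by positivity) hcon
    have e2 : a * ((L / a + 1) * E) < a * s := mul_lt_mul_of_pos_left hcon ha
    have e3 : a * ((L / a + 1) * E) = L * E + a * E := by field_simp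
    have e4 := mul_lt_mul_of_pos_right e2 e1
    have e5 : L * E ≤ a * s := by nlinarith [mul_nonneg ha.le hE0]
    nlinarith [mul_le_mul_of_nonneg_left e5 hE0]
  have : N + y ≤ (1 + K + M / b) * s + (2 + 1 / b) * E := by linarith
  have h6 := mul_le_mul_of_nonneg_left hsE (show 0 ≤ 1 + K + M / b by positivity)
  linarith

/-- The a priori estimate for solutions of the discrete system, with its constant. -/
theorem normX_add_norm_yL2_le {m : Material} (hd : d = 2 ∨ d = 3) {Q : Rule} (hΩ : IsOpen Ω)
    (hΓ : Γn ⊆ frontier Ω) (hV : V.Conforming Γn ℓ)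
    (hdiv : V.DivSubset Γn) {β c₁ c₂ α M K : ℝ} (hβ : 0 < β) (hc₁ : 0 < c₁)
    (hs : V.ElasticityStable Γn β)
    (hQ : ∀ η : V.X, c₁ * normL2 η ≤ normQ Q η ∧ normQ Q η ≤ c₂ * normL2 η)
    (hα : 0 < α) (hM : 0 ≤ M) (hK : 0 ≤ K)
    (hcS : ∀ τ : StressVal d, α * ‖τ‖ ^ 2 ≤ ⟪m.complSLM τ, τ⟫_ℝ)
    (hcW : ∀ τ : CoupleVal d, α * ‖τ‖ ^ 2 ≤ ⟪m.complWLM τ, τ⟫_ℝ)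
    (hbS : ∀ τ : StressVal d, ‖m.complSLM τ‖ ≤ M * ‖τ‖)
    (hbW : ∀ τ : CoupleVal d, ‖m.complWLM τ‖ ≤ M * ‖τ‖)
    (hasym : ∀ σ : L2 Ω (Fin d × Fin d), ‖asymL2 Ω σ‖ ≤ K * ‖σ‖)
    {g : V.X →ₗ[ℝ] ℝ} {f : SpaceY Ω →L[ℝ] ℝ} {p : V.X × V.Y}
    (hp : IsSolution m Q Γn ℓ g f p) :
    normX Γn ℓ p.1 + ‖yL2 p.2‖ ≤
      stabilityConst (α * c₁ ^ 2) (β / 2) K (M * c₂ ^ 2) * (dualNormX Γn ℓ g + ‖f‖) := by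
  obtain ⟨η, v⟩ := p
  have hf : ∀ w : V.Y, f (yL2 w) ≤ ‖f‖ * ‖yL2 w‖ := fun w =>
    (le_abs_self _).trans (f.le_opNorm _)
  have hs0 : 0 ≤ normL2 η := Real.sqrt_nonneg _
  have hB : ∀ w : V.Y, formB Γn ℓ η w = f (yL2 w) := by
    intro w
    have h := hp 0 w
    have hA0 : formA m Q η 0 = 0 := by simpa using formA_smul_right m hd Q 0 η 0
    have hB0 : formB Γn ℓ 0 v = 0 := by simpa using formB_smul_left hΩ hΓ hV 0 0 v
    simpa [hA0, hB0] using h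
  have hA : ∀ η', formA m Q η η' - formB Γn ℓ η' v = g η' := by
    intro η'
    have h := hp η' 0
    have hB0 : formB Γn ℓ η 0 = 0 := by simpa using formB_smul_right (Γn := Γn) (ℓ := ℓ) 0 η 0
    have hy0 : yL2 (0 : V.Y) = 0 := by simpa using yL2_smul 0 (0 : V.Y)
    simpa [hB0, hy0] using h
  refine energy_closing (s := normL2 η) (D := ‖divS Γn η.1‖)
    (P := ‖V.RL2.starProjection (divW Γn ℓ η.2)‖) (by positivity) (by positivity) hK
    (by positivity) hs0 (dualNormX_nonneg g) (norm_nonneg f) ?_ ?_ ?_ ?_ (normX_le_add η)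
  -- Energy identity: test with `η' = η` and replace `⟨Bη, v⟩` by `f(v)`.
  · have h1 := formA_coercive hd hcS hcW Q η
    have h2 : c₁ ^ 2 * normL2 η ^ 2 ≤ normQ Q η ^ 2 := by
      rw [← mul_pow]
      exact pow_le_pow_left₀ (by positivity) (hQ η).1 2
    have h3 := hA η
    have h4 := le_dualNormX_mul (Γn := Γn) (ℓ := ℓ) g η
    have h5 := hf v
    rw [← hB v] at h5
    have h6 := mul_le_mul_of_nonneg_left h2 hα.le
    dsimp only
    linarith
  -- Test with `(-∇⋅σ, 0)`, which gives `‖∇⋅σ‖² ≤ ‖f‖ ‖∇⋅σ‖`.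
  · obtain ⟨u, hu, hud⟩ := hdiv η.1
    have h1 := hB (-⟨u, hu⟩, 0)
    have h2 := hf (-⟨u, hu⟩, 0)
    have h3 := norm_yL2_le_add ((-⟨u, hu⟩, 0) : V.Y)
    simp only [formB, Submodule.coe_neg, map_neg, inner_neg_right, Submodule.coe_zero, map_zero,
      inner_zero_right, hud, real_inner_self_eq_norm_sq, norm_neg, norm_zero] at h1 h3
    by_contra! hcon
    have h4 := mul_le_mul_of_nonneg_left h3 (norm_nonneg f)
    have h5 := mul_lt_mul_of_pos_right hcon (lt_of_le_of_lt (norm_nonneg f) hcon)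
    nlinarith
  -- Test with `(0, -P)`, `P = Π_R ∇⋅(ℓω)`. Self-adjointness of the projection turns `(∇⋅(ℓω), P)`
  -- into `‖P‖²`, leaving the asymmetry term on the right.
  · obtain ⟨r, hr, hrd⟩ := Submodule.mem_map.1
      (V.RL2.starProjection_apply_mem (divW Γn ℓ η.2))
    have h0 : ⟪divW Γn ℓ η.2, V.RL2.starProjection (divW Γn ℓ η.2)⟫_ℝ
        = ‖V.RL2.starProjection (divW Γn ℓ η.2)‖ ^ 2 := by
      rw [← real_inner_self_eq_norm_sq, Submodule.inner_starProjection_left_eq_right,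
        Submodule.starProjection_eq_self_iff.2 (V.RL2.starProjection_apply_mem _)]
    have h1 := hB (0, -⟨r, hr⟩)
    have h2 := hf (0, -⟨r, hr⟩)
    have h3 := norm_yL2_le_add ((0, -⟨r, hr⟩) : V.Y)
    simp only [formB, Submodule.coe_neg, map_neg, inner_neg_right, Submodule.coe_zero, map_zero,
      inner_zero_right, hrd, h0, norm_neg, norm_zero] at h1 h3
    set P := V.RL2.starProjection (divW Γn ℓ η.2)
    have h4 := mul_le_mul_of_nonneg_left h3 (norm_nonneg f)
    have h5 : ⟪asymL2 Ω (toL2 η.1.1), P⟫_ℝ ≤ K * normL2 η * ‖P‖ :=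
      (real_inner_le_norm _ _).trans (mul_le_mul_of_nonneg_right ((hasym _).trans
        (mul_le_mul_of_nonneg_left (norm_fst_le_normL2 η) hK)) (norm_nonneg _))
    by_contra! hcon
    have h6 : 0 < ‖P‖ := lt_of_le_of_lt (by positivity) hcon
    have h7 := mul_lt_mul_of_pos_right hcon h6
    nlinarith
  · by_cases hv : v = 0
    · have hy0 : yL2 (0 : V.Y) = 0 := by simpa using yL2_smul 0 (0 : V.Y)
      subst hv
      simp only [hy0, norm_zero, mul_zero]
      have := dualNormX_nonneg (Γn := Γn) (ℓ := ℓ) g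
      positivity
    -- For the inf-sup field `η'`, `-⟨Bη', v⟩ = g(η') - ⟨A_h η, η'⟩`; bound the right side by a
    -- multiple of `‖η'‖_X` and divide.
    · obtain ⟨η', hpos, hη'⟩ := exists_formB_ge hΩ hΓ hV hβ hs hv
      have h1 := hA η'
      have h2 := le_dualNormX_mul (Γn := Γn) (ℓ := ℓ) g η'
      have h3 := (abs_le.1 (abs_formA_le hd hM hbS hbW Q η η')).1
      have h4 : M * normQ Q η * normQ Q η' ≤ M * c₂ ^ 2 * normL2 η * normX Γn ℓ η' := by
        have e1 : normQ Q η * normQ Q η' ≤ (c₂ * normL2 η) * (c₂ * normL2 η') :=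
          mul_le_mul (hQ η).2 (hQ η').2 (Real.sqrt_nonneg _)
            ((Real.sqrt_nonneg _).trans (hQ η).2)
        have e2 : normL2 η * normL2 η' ≤ normL2 η * normX Γn ℓ η' :=
          mul_le_mul_of_nonneg_left (normL2_le_normX η') hs0
        have e3 := mul_le_mul_of_nonneg_left e1 hM
        have e4 := mul_le_mul_of_nonneg_left e2 (show 0 ≤ M * c₂ ^ 2 by positivity)
        linarith
      refine le_of_mul_le_mul_right ?_ hpos
      linarith

end FESpaces

end

end Cosserat

/-! ### Well-posedness with a uniform constant -/

theorem mainTheorem6 (d : ℕ) (hd : d = 2 ∨ d = 3) (m : Cosserat.Material)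
    (β c₁ c₂ : ℝ) (hβ : 0 < β) (hc₁ : 0 < c₁) (hc₂ : 0 < c₂) :
    ∃ C : ℝ, 0 < C ∧
      ∀ (Ω Γe Γn : Set (Cosserat.Pt d)), Cosserat.IsLipschitzDomain Ω →
        Γe ∪ Γn = frontier Ω → Disjoint Γe Γn →
      ∀ (ℓ : Cosserat.Pt d → ℝ), Cosserat.IsLengthScale Ω ℓ →
      ∀ (𝒯 : Cosserat.Tessellation Ω) (V : Cosserat.FESpaces 𝒯) (Q : Cosserat.Tessellation.Rule),
        V.Conforming Γn ℓ →
        V.DivSubset Γn →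
        V.ElasticityStable Γn β →
        (∀ η : V.X, c₁ * Cosserat.FESpaces.normL2 η ≤ Cosserat.FESpaces.normQ Q η ∧
          Cosserat.FESpaces.normQ Q η ≤ c₂ * Cosserat.FESpaces.normL2 η) →
      ∀ (g : V.X →ₗ[ℝ] ℝ) (f : Cosserat.SpaceY Ω →L[ℝ] ℝ),
        (∃! p : V.X × V.Y, Cosserat.FESpaces.IsSolution m Q Γn ℓ g f p) ∧
        ∀ p : V.X × V.Y, Cosserat.FESpaces.IsSolution m Q Γn ℓ g f p →
          Cosserat.FESpaces.normX Γn ℓ p.1 + ‖Cosserat.FESpaces.yL2 p.2‖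
            ≤ C * (Cosserat.FESpaces.dualNormX Γn ℓ g + ‖f‖) := by
  obtain ⟨αS, hαS, hcS⟩ := m.exists_complS_coercive d
  obtain ⟨αW, hαW, hcW⟩ := m.exists_complW_coercive hd
  obtain ⟨MS, hMS, hbS⟩ := (LinearMap.toContinuousLinearMap (m.complSLM (d := d))).bound
  obtain ⟨MW, hMW, hbW⟩ := (LinearMap.toContinuousLinearMap (m.complWLM (d := d))).bound
  obtain ⟨K, hK, hasym⟩ := Cosserat.FESpaces.norm_asymL2_le d
  have hα : 0 < min αS αW := lt_min hαS hαW
  have hM : 0 < max MS MW := lt_max_of_lt_left hMS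
  -- The constant is fixed before the domain, the mesh and `ℓ` are introduced, which is the claimed
  -- uniformity.
  refine ⟨Cosserat.FESpaces.stabilityConst (min αS αW * c₁ ^ 2) (β / 2) K (max MS MW * c₂ ^ 2),
    Cosserat.FESpaces.stabilityConst_pos (by positivity) (by positivity) hK (by positivity),
    fun Ω Γe Γn hLip hΓ _ ℓ hℓ 𝒯 V Q hV hdiv hs hQ => ?_⟩
  have hΩ := hLip.1
  have hΓn : Γn ⊆ frontier Ω := hΓ ▸ Set.subset_union_right
  have est := fun (g : V.X →ₗ[ℝ] ℝ) (f : Cosserat.SpaceY Ω →L[ℝ] ℝ) (p : V.X × V.Y)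
      (hp : Cosserat.FESpaces.IsSolution m Q Γn ℓ g f p) =>
    Cosserat.FESpaces.normX_add_norm_yL2_le hd hΩ hΓn hV hdiv hβ hc₁ hs hQ hα hM.le hK
      (fun τ => (mul_le_mul_of_nonneg_right (min_le_left αS αW) (sq_nonneg _)).trans (hcS τ))
      (fun τ => (mul_le_mul_of_nonneg_right (min_le_right αS αW) (sq_nonneg _)).trans (hcW τ))
      (fun τ => (hbS τ).trans
        (mul_le_mul_of_nonneg_right (le_max_left MS MW) (norm_nonneg _)))
      (fun τ => (hbW τ).trans
        (mul_le_mul_of_nonneg_right (le_max_right MS MW) (norm_nonneg _)))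
      (hasym Ω) hp
  refine fun g f => ⟨?_, est g f⟩
  simp only [Cosserat.FESpaces.isSolution_iff m hd Q hΩ hΓn hV hℓ]
  refine Cosserat.FESpaces.existsUnique_of_forall_eq_zero (E := V.X × V.Y)
    (Cosserat.FESpaces.systemForm m hd Q hΩ hΓn hV hℓ) (fun p hp => ?_)
    (Cosserat.FESpaces.systemData g f)
  -- An element of the kernel solves the system with zero data, so the estimate forces both of its
  -- norms to vanish.
  have hsol : Cosserat.FESpaces.IsSolution m Q Γn ℓ 0 0 p := by
    rw [Cosserat.FESpaces.isSolution_iff m hd Q hΩ hΓn hV hℓ, hp]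
    ext q <;> simp [Cosserat.FESpaces.systemData]
  have h := est 0 0 p hsol
  have h0 : Cosserat.FESpaces.dualNormX Γn ℓ (0 : V.X →ₗ[ℝ] ℝ) = 0 := by
    simp [Cosserat.FESpaces.dualNormX]
  rw [h0, norm_zero, add_zero, mul_zero] at h
  have h1 := Cosserat.FESpaces.normX_nonneg (Γn := Γn) (ℓ := ℓ) p.1
  have h2 := norm_nonneg (Cosserat.FESpaces.yL2 p.2)
  exact Prod.ext
    (Cosserat.FESpaces.eq_zero_of_normX_eq_zero (Γn := Γn) (ℓ := ℓ) (by linarith))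
    (Cosserat.FESpaces.eq_zero_of_norm_yL2_eq_zero (by linarith))
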